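/- Throughout, $n=2p$, formal maps fix the origin, $L F$ denotes the linear part at $0$ of a formal map $F$, and $\bar z'$ is treated as an independent formal variable $w'$. A formal submanifold is $$M\colon\ z_{p+j}=E_j(z',\bar z'),\quad 1\le j\le p,\qquad z'=(z_1,\dots,z_p),\quad z''=(z_{p+1},\dots,z_{2p}),$$ where $E_1,\dots,E_p$ are formal power series in $(z',\bar z')$ without constant and linear terms. Let $q_j(w')$ be the quadratic part of $E_j(0,w')$. A formal deck transformation of $\pi_1$ is a formal biholomorphic map $\tau(z',w')=(z',f(z',w'))$ of $\mathbb C^{2p}$ with $E\circ\tau=E$. $M$ satisfies condition D if $q_1=\dots=q_p=0$ only at $w'=0$ and $\pi_1$ has exactly $2^p$ formal deck transformations. Let $\rho_0(z',w')=(\overline{w'},\overline{z'})$. The formal fixed-point set $\operatorname{Fix}(F)$ is defined by the radical of the ideal generated by the components of $F-\mathrm{id}$; it is a hypersurface if this radical is generated by one series $r$ with $r(0)=0$, $dr(0)\ne0$; its tangent space at $0$ is the common kernel of $dr(0)$ over all $r$ in the radical. The family of involutions associated with a manifold $M$ satisfying D is the set $\{\tau_{11},\dots,\tau_{1p}\}$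 of $p$ distinct generators of the group of formal deck transformations of $\pi_1$ such that each $\operatorname{Fix}(\tau_{1j})$ is a hypersurface; this family exists and is unique up to order. $M$ and $\tilde M$ are formally equivalent if $f(M)=\tilde M$ for a formal biholomorphic map $f$ of $(\mathbb C^{2p},0)$, i.e. $f$ and $f^{-1}$ pull back the ideals of $\mathbb C[[z,\bar z]]$ defining $\tilde M$ and $M$ into those defining $M$ and $\tilde M$, respectively. Two families $\{\tau_{11},\dots,\tau_{1p},\rho\}$ and $\{\tilde\tau_{11},\dots,\tilde\tau_{1p},\tilde\rho\}$, with $\rho,\tilde\rho$ anti-holomorphic formal involutions, are formally equivalent if there are a formal biholomorphic map $F$ and a permutation $j\mapsto i_j$ with $F\rho=\tilde\rho F$ and $F\tau_{1j}F^{-1}=\tilde\tau_{1i_j}$ for all $j$. **Proposition.** (i) Let $M,\tilde M$ be formal submanifolds as above that satisfy condition D. Then $M$ and $\tilde M$ are formally equivalent if and only if their associated families $\{\tau_{11},\dots,\tau_{1p},\rho_0\}$ and $\{\tilde\tau_{11},\dots,\tilde\tau_{1p},\rho_0\}$ are formally equivalent. (ii) Let $\tau_{11},\dots,\tau_{1p}$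 be pairwise commuting formal holomorphic involutions of $(\mathbb C^{2p},0)$ such that the tangent spaces at $0$ of $\operatorname{Fix}(\tau_{11}),\dots,\operatorname{Fix}(\tau_{1p})$ are hyperplanes intersecting transversally (their intersection has codimension $p$). Let $\rho$ be an anti-holomorphic formal involution of $(\mathbb C^{2p},0)$ and put $\tau_{2j}=\rho\tau_{1j}\rho$, $\tau_i=\tau_{i1}\cdots\tau_{ip}$. Suppose that the linear part of $\sigma=\tau_1\tau_2$ has $2p$ distinct eigenvalues, and that $0$ is the only linear function that is invariant under all $L\tau_{1j}$ and all $L\tau_{2j}$. Then there are formal power series $B_1,\dots,B_p$ such that $$M\colon\ z''=(B_1^2,\dots,B_p^2)(z',\bar z')$$ is a formal submanifold as above, $M$ satisfies condition D, and its associated family $\{\tilde\tau_{11},\dots,\tilde\tau_{1p},\rho_0\}$ is formally equivalent to $\{\tau_{11},\dots,\tau_{1p},\rho\}$. -/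

import Mathlib

noncomputable section

namespace CRSing

open MvPowerSeries

/-- A formal holomorphic self-map of `ℂ^σ` fixing the origin: a family of formal power series
without constant terms. -/
@[ext]
structure FormalMap (σ : Type) where
  toFun : σ → MvPowerSeries σ ℂ
  map_zero : ∀ i, constantCoeff (toFun i) = 0

variable {σ : Type} [Finite σ]

theorem FormalMap.hasSubst (F : FormalMap σ) : HasSubst F.toFun :=
  hasSubst_of_constantCoeff_zero F.map_zero

/-- The product of formal maps is the composition: `(F * G)(x) = F (G x)`. The units of this
monoid are the formal biholomorphic maps. -/
instance : Monoid (FormalMap σ) where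
  mul F G := ⟨fun i => subst G.toFun (F.toFun i),
    fun i => constantCoeff_subst_eq_zero G.hasSubst G.map_zero (F.map_zero i)⟩
  one := ⟨fun i => X i, fun i => constantCoeff_X i⟩
  mul_assoc F G H := by
    apply FormalMap.ext
    funext i
    exact subst_comp_subst_apply G.hasSubst H.hasSubst (F.toFun i)
  one_mul F := by
    apply FormalMap.ext
    funext i
    exact subst_X F.hasSubst i
  mul_one F := by
    apply FormalMap.ext
    funext i
    exact congrFun (subst_self (R := ℂ)) (F.toFun i)

theorem FormalMap.mul_toFun (F G : FormalMap σ) (i : σ) :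
    (F * G).toFun i = subst G.toFun (F.toFun i) := rfl

theorem FormalMap.one_toFun (i : σ) : (1 : FormalMap σ).toFun i = X i := rfl

/-- Conjugation of all coefficients of a power series: `f ↦ \bar f`, `\bar f (x) = conj (f (conj x))`. -/
def conj {τ : Type} (f : MvPowerSeries τ ℂ) : MvPowerSeries τ ℂ :=
  MvPowerSeries.map (starRingEnd ℂ) f

/-- `F ↦ \bar F`, conjugation of the coefficients of a formal map. -/
def FormalMap.bar : FormalMap σ →* FormalMap σ where
  toFun F := ⟨fun i => conj (F.toFun i), fun i => by
    rw [conj, MvPowerSeries.constantCoeff_map, F.map_zero, RingHom.map_zero]⟩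
  map_one' := by
    apply FormalMap.ext
    funext i
    exact MvPowerSeries.map_X _ i
  map_mul' F G := by
    apply FormalMap.ext
    funext i
    exact map_subst G.hasSubst (F.toFun i)

/-- The group of formal biholomorphic maps of `(ℂ^σ, 0)` under composition. -/
abbrev FormalBihol (σ : Type) [Finite σ] := (FormalMap σ)ˣ

/-- The components of a formal biholomorphic map. -/
def comps (F : FormalBihol σ) : σ → MvPowerSeries σ ℂ := (F : FormalMap σ).toFun

/-- `\bar F` for a formal biholomorphic map `F`. -/
def bar : FormalBihol σ →* FormalBihol σ := Units.map FormalMap.bar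

/-- The matrix of the linear part `LF` of `F` at the origin. -/
def linearPart (F : FormalBihol σ) : Matrix σ σ ℂ :=
  Matrix.of fun i k => coeff (Finsupp.single k 1) (comps F i)

/-- An anti-holomorphic formal map `ρ`, written as `ρ(x) = R(conj x)` with `R` formal
biholomorphic, which is an involution; as `ρ(ρ(x)) = R(\bar R(x))`, this says `R ∘ \bar R = id`. -/
structure AntiInvolution (σ : Type) [Finite σ] where
  R : FormalBihol σ
  invol : R * bar R = 1

/-- The formal holomorphic map `ρ ∘ F ∘ ρ`, that is `x ↦ R (\bar F (\bar R x))`. -/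
def AntiInvolution.conjugate (ρ : AntiInvolution σ) (F : FormalBihol σ) : FormalBihol σ :=
  ρ.R * bar F * bar ρ.R

/-- `F` intertwines two anti-holomorphic involutions: `F ∘ ρ = ρ' ∘ F`, that is
`F (R (conj x)) = R' (\bar F (conj x))`. -/
def Intertwines (F : FormalBihol σ) (ρ ρ' : AntiInvolution σ) : Prop :=
  F * ρ.R = ρ'.R * bar F

/-- The families `{τ₁, …, τ_p, ρ}` and `{τ'₁, …, τ'_p, ρ'}` are formally equivalent: some formal
biholomorphic map conjugates `ρ` to `ρ'` and the `τ_j`, up to their order, to the `τ'_j`. -/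
def FamilyEquivalent {p : ℕ} (τ : Fin p → FormalBihol σ) (ρ : AntiInvolution σ)
    (τ' : Fin p → FormalBihol σ) (ρ' : AntiInvolution σ) : Prop :=
  ∃ F : FormalBihol σ, Intertwines F ρ ρ' ∧
    ∃ e : Equiv.Perm (Fin p), ∀ j, F * τ j * F⁻¹ = τ' (e j)

/-- The linear part at the origin of a formal power series, as a linear function: `dr(0)`. -/
def differential [Fintype σ] (r : MvPowerSeries σ ℂ) : Module.Dual ℂ (σ → ℂ) :=
  ∑ i, coeff (Finsupp.single i 1) r • LinearMap.proj i

/-- The ideal of the formal fixed-point set `Fix(F)`: the radical of the ideal generated by the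
components of `F - id`. -/
def fixIdeal (F : FormalBihol σ) : Ideal (MvPowerSeries σ ℂ) :=
  (Ideal.span (Set.range fun i => comps F i - X i)).radical

/-- The tangent space at the origin of the formal set with ideal `I`. -/
def tangentSpace [Fintype σ] (I : Ideal (MvPowerSeries σ ℂ)) : Submodule ℂ (σ → ℂ) :=
  ⨅ r ∈ I, LinearMap.ker (differential r)

/-- The radical ideal `I` defines a formal (smooth) hypersurface through the origin. -/
def IsFormalHypersurface [Fintype σ] (I : Ideal (MvPowerSeries σ ℂ)) : Prop :=
  ∃ r : MvPowerSeries σ ℂ, I = Ideal.span {r} ∧ constantCoeff r = 0 ∧ differential r ≠ 0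

/-- The space `[𝔐]₁^{L𝓕}` of linear functions which are invariant under the linear parts of all
members of the family `𝓕`. -/
def linearInvariants [Fintype σ] [DecidableEq σ] {p : ℕ} (𝓕 : Fin p → FormalBihol σ) :
    Submodule ℂ (Module.Dual ℂ (σ → ℂ)) :=
  ⨅ j, LinearMap.eqLocus
    (LinearMap.lcomp ℂ ℂ (Matrix.toLin' (linearPart (𝓕 j)))) LinearMap.id

/-- The composition `τ₁ ∘ τ₂ ∘ ⋯ ∘ τ_p`. -/
def composite {p : ℕ} (τ : Fin p → FormalBihol σ) : FormalBihol σ := (List.ofFn τ).prod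

/-- The variables of the complexification: `Sum.inl j` is `z_j` and `Sum.inr j` is `w_j`, the
formal variable that stands for `conj z_j` (`j = 1, …, p`). -/
abbrev ZW (p : ℕ) := Fin p ⊕ Fin p

/-- The exchange `(z', w') ↦ (w', z')`. -/
def swap (p : ℕ) : FormalMap (ZW p) :=
  ⟨fun i => X i.swap, fun i => constantCoeff_X i.swap⟩

theorem swap_mul_swap (p : ℕ) : swap p * swap p = 1 := by
  apply FormalMap.ext
  funext i
  rw [FormalMap.mul_toFun, FormalMap.one_toFun]
  change subst (swap p).toFun (X i.swap) = X i
  rw [subst_X (swap p).hasSubst]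
  change X i.swap.swap = X i
  rw [Sum.swap_swap]

/-- The anti-holomorphic involution `ρ₀(z', w') = (conj w', conj z')`. -/
def rho0 (p : ℕ) : AntiInvolution (ZW p) where
  R := ⟨swap p, swap p, swap_mul_swap p, swap_mul_swap p⟩
  invol := by
    have hbar : FormalMap.bar (swap p) = swap p := by
      apply FormalMap.ext
      funext i
      exact MvPowerSeries.map_X _ i.swap
    apply Units.ext
    change swap p * FormalMap.bar (swap p) = 1
    rw [hbar, swap_mul_swap]

/-- A formal submanifold `z_{p+j} = E_j(z', conj z')`, `1 ≤ j ≤ p`, of `ℂ^{2p}`, where the `E_j` are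
formal power series in `(z', conj z')` without constant or linear terms. -/
structure FormalSubmanifold (p : ℕ) where
  E : Fin p → MvPowerSeries (ZW p) ℂ
  two_le_order : ∀ j, 2 ≤ (E j).order

namespace FormalSubmanifold

variable {p : ℕ}

/-- The part `q_j(w')` of the quadratic form of `E_j(z', w')` that depends on `w'` only. -/
def q (M : FormalSubmanifold p) (j : Fin p) : MvPolynomial (Fin p) ℂ :=
  ∑ d ∈ (Finset.univ : Finset (Fin p)).finsuppAntidiag 2,
    MvPolynomial.monomial d (coeff (Finsupp.mapDomain Sum.inr d) (M.E j))

/-- Condition B: `q` vanishes only at the origin. -/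
def ConditionB (M : FormalSubmanifold p) : Prop :=
  ∀ w : Fin p → ℂ, (∀ j, MvPolynomial.eval w (M.q j) = 0) → w = 0

/-- The group of formal deck transformations of `π₁`: formal biholomorphic maps of the form
`(z', w') ↦ (z', f(z', w'))` with `E(z', f(z', w')) = E(z', w')`. -/
def deck (M : FormalSubmanifold p) : Subgroup (FormalBihol (ZW p)) where
  carrier := {τ | (∀ i, comps τ (Sum.inl i) = X (Sum.inl i)) ∧
    ∀ j, subst (comps τ) (M.E j) = M.E j}
  one_mem' := ⟨fun _ => rfl, fun j => congrFun (subst_self (R := ℂ)) (M.E j)⟩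
  mul_mem' := by
    rintro a b ⟨ha, ha'⟩ ⟨hb, hb'⟩
    have hA : HasSubst (comps a) := FormalMap.hasSubst _
    have hB : HasSubst (comps b) := FormalMap.hasSubst _
    refine ⟨fun i => ?_, fun j => ?_⟩
    · change subst (comps b) (comps a (Sum.inl i)) = _
      rw [ha, subst_X hB, hb]
    · change subst (fun s => subst (comps b) (comps a s)) (M.E j) = _
      rw [← subst_comp_subst_apply hA hB, ha', hb']
  inv_mem' := by
    rintro a ⟨ha, ha'⟩
    have hA : HasSubst (comps a) := FormalMap.hasSubst _
    have hB : HasSubst (comps a⁻¹) := FormalMap.hasSubst _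
    have h : ∀ s, subst (comps a⁻¹) (comps a s) = X s := fun s =>
      congrFun (congrArg FormalMap.toFun a.mul_inv) s
    refine ⟨fun i => ?_, fun j => ?_⟩
    · have := h (Sum.inl i)
      rwa [ha, subst_X hB] at this
    · have := subst_comp_subst_apply hA hB (M.E j)
      rw [ha', funext h] at this
      exact this.trans (congrFun (subst_self (R := ℂ)) (M.E j))

/-- Condition D: condition B holds and `π₁` has the maximal number `2^p` of formal deck
transformations. -/
def ConditionD (M : FormalSubmanifold p) : Prop :=
  M.ConditionB ∧ Nat.card M.deck = 2 ^ p

/-- `{τ₁, …, τ_p}` is the family of involutions associated with `M`: `p` distinct generators of the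
group of deck transformations of `π₁`, each of which fixes a hypersurface. -/
def IsAssociatedFamily (M : FormalSubmanifold p) (τ : Fin p → FormalBihol (ZW p)) : Prop :=
  Function.Injective τ ∧ Subgroup.closure (Set.range τ) = M.deck ∧
    ∀ j, IsFormalHypersurface (fixIdeal (τ j))

/-- The coordinates `z = (z', z'')` and `w = (w', w'')` of `ℂ^{2p} × ℂ^{2p}`, `w` being the formal
variable for `conj z`: the left copy of `ZW p` indexes `z`, the right one `w`; in each of them
`Sum.inl` indexes the first `p` coordinates and `Sum.inr` the last `p`. -/
abbrev Ambient (p : ℕ) := (Fin p ⊕ Fin p) ⊕ (Fin p ⊕ Fin p)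

/-- The ideal `I(M)` in `ℂ[[z, conj z]]`, generated by `z'' - E(z', conj z')` and by the conjugate
equations `conj z'' - \bar E(conj z', z')`. -/
def ideal (M : FormalSubmanifold p) : Ideal (MvPowerSeries (Ambient p) ℂ) :=
  Ideal.span
    (Set.range (fun j : Fin p => X (Sum.inl (Sum.inr j)) -
        subst (Sum.elim (fun i => X (Sum.inl (Sum.inl i))) (fun i => X (Sum.inr (Sum.inl i))) :
          ZW p → MvPowerSeries (Ambient p) ℂ) (M.E j)) ∪
      Set.range (fun j : Fin p => X (Sum.inr (Sum.inr j)) -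
        subst (Sum.elim (fun i => X (Sum.inr (Sum.inl i))) (fun i => X (Sum.inl (Sum.inl i))) :
          ZW p → MvPowerSeries (Ambient p) ℂ) (conj (M.E j))))

/-- The map `(z, conj z) ↦ (f(z), conj (f(z)))`, i.e. `(z, w) ↦ (f(z), \bar f(w))`. -/
def complexify (f : FormalBihol (Fin p ⊕ Fin p)) : Ambient p → MvPowerSeries (Ambient p) ℂ :=
  Sum.elim
    (fun i => subst (fun k => X (Sum.inl k) :
      Fin p ⊕ Fin p → MvPowerSeries (Ambient p) ℂ) (comps f i))
    (fun i => subst (fun k => X (Sum.inr k) :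
      Fin p ⊕ Fin p → MvPowerSeries (Ambient p) ℂ) (conj (comps f i)))

/-- The formal holomorphic map `f` of `ℂ^{2p}` maps `M` into `M'`: `I(M') ∘ f ⊆ I(M)`. -/
def MapsInto (f : FormalBihol (Fin p ⊕ Fin p)) (M M' : FormalSubmanifold p) : Prop :=
  ∀ r ∈ M'.ideal, subst (complexify f) r ∈ M.ideal

/-- `M` and `M'` are formally equivalent: `f(M) = M'` for a formal biholomorphic map `f` of
`(ℂ^{2p}, 0)`. -/
def FormallyEquivalent (M M' : FormalSubmanifold p) : Prop :=
  ∃ f : FormalBihol (Fin p ⊕ Fin p), MapsInto f M M' ∧ MapsInto f⁻¹ M' M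

end FormalSubmanifold

end CRSing

end

noncomputable section

namespace CRSing

open MvPowerSeries

/-! ### Orders of power series and leading terms of substitutions -/

section Order

variable {τ : Type}

/-! Under condition D the map $(z',E)$ is, up to coordinate changes, the branched cover
$(z',w')\mapsto(z',w_1^2,\dots,w_p^2)$, and everything follows from this normal form.

Restricting $E\circ\tau=E$ to the lines $t\mapsto(0,tw)$ and reading off the $t^2$-coefficient shows
that the $w'$-block of $L\tau$ preserves every $q_j$ (`eval_q_wBlock`). On an eigenvector with
eigenvalue $\mu$ this gives $\mu^2q_j=q_j$ with some $q_j\ne0$, so $\mu=\pm1$. The deck group is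
finite, so these blocks are diagonalizable and square to the identity. Averaging over finite groups
shows that the blocks determine the deck transformations, and that the group becomes a group of sign
changes of $w'$ in coordinates $U$ that keep $z'$. Since it has $2^p$ elements it contains all sign
changes (`exists_normalizing_coordinates`). A sign change fixes a hypersurface exactly when it
changes one sign; these reflections form the associated family.

For (i), series even in each $w_k$ are series in $z'$ and the $w_k^2$, so
$(z',E)=e\circ(z',w'^2)\circ U$, and condition B makes $e$ biholomorphic (`exists_param_eq`). Hence
deck-invariant maps factor uniquely through $(z',E)$. The ideal of $M$ is the kernel of the pullback
to the complexified parametrization (`mem_ideal_iff`), so $f$ maps $M$ into $M'$ exactly when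
$f\circ(z',E)=(z',E')\circ G$ for some $G$ commuting with $\rho_0$ (`mapsInto_iff`). An equivalence
$f$ thus lifts to a $G$ that conjugates the deck groups, and conversely a map commuting with
$\rho_0$ that conjugates the deck groups descends to some $f$.

For (ii), averaging turns the $\tau_{1j}$ into the reflections of some coordinates $U=(A,B)$
(`exists_eq_reflections`). The components of $A$ are invariant under the $\tau_{1j}$, those of
$\overline{A\circ\rho}$ under the $\tau_{2j}$. As no nonzero linear function is invariant under both
linear families, $\Phi=(A,\overline{A\circ\rho})$ is biholomorphic, and it carries $\rho$ to
$\rho_0$ (`exists_intertwining_coordinates`). In these coordinates $A$ becomes $z'$, and squaring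
the components of $B\circ\Phi^{-1}$ gives a manifold whose associated family is the transported one.
-/

theorem natCast_le_order_iff {f : MvPowerSeries τ ℂ} {n : ℕ} :
    (n : ℕ∞) ≤ f.order ↔ ∀ d : τ →₀ ℕ, d.degree < n → coeff d f = 0 :=
  ⟨fun h _ hd => coeff_of_lt_order (lt_of_lt_of_le (by exact_mod_cast hd) h), nat_le_order⟩

theorem natCast_le_order_add {f g : MvPowerSeries τ ℂ} {n : ℕ} (hf : (n : ℕ∞) ≤ f.order)
    (hg : (n : ℕ∞) ≤ g.order) : (n : ℕ∞) ≤ (f + g).order :=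
  (le_min hf hg).trans min_order_le_add

theorem natCast_le_order_mul {f g : MvPowerSeries τ ℂ} {m n : ℕ} (hf : (m : ℕ∞) ≤ f.order)
    (hg : (n : ℕ∞) ≤ g.order) : ((m + n : ℕ) : ℕ∞) ≤ (f * g).order := by
  push_cast
  exact (add_le_add hf hg).trans le_order_mul

theorem natCast_le_order_of_constantCoeff {f : MvPowerSeries τ ℂ} (hf : constantCoeff f = 0) :
    ((1 : ℕ) : ℕ∞) ≤ f.order := by
  exact_mod_cast one_le_order_iff_constCoeff_eq_zero.mpr hf

end Order

theorem exists_eq_single_of_degree_eq_one {σ : Type} {d : σ →₀ ℕ} (h : d.degree = 1) :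
    ∃ i, d = Finsupp.single i 1 := by
  classical
  have hd : d ≠ 0 := by
    rintro rfl
    simp at h
  obtain ⟨i, hi⟩ := Finsupp.ne_iff.mp hd
  refine ⟨i, ?_⟩
  have h1 : Finsupp.single i 1 ≤ d := by
    rw [Finsupp.single_le_iff]
    exact Nat.one_le_iff_ne_zero.mpr hi
  obtain ⟨e, rfl⟩ := exists_add_of_le h1
  rw [map_add, Finsupp.degree_single] at h
  have : e = 0 := by
    rw [← Finsupp.degree_eq_zero_iff]
    omega
  rw [this, add_zero]

section Leading

variable {σ τ : Type} [Finite σ]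

theorem hasSubst_zero {a : σ → MvPowerSeries τ ℂ} (ha : ∀ i, constantCoeff (a i) = 0) :
    HasSubst a := hasSubst_of_constantCoeff_zero ha

omit [Finite σ] in
theorem degree_le_order_prod {a : σ → MvPowerSeries τ ℂ} (ha : ∀ i, constantCoeff (a i) = 0)
    (d : σ →₀ ℕ) : (d.degree : ℕ∞) ≤ (d.prod fun i k => a i ^ k).order := by
  induction d using Finsupp.induction_linear with
  | zero => simp
  | add x y hx hy =>
    rw [Finsupp.prod_add_index' (by simp) (by intros; rw [pow_add]), map_add]
    exact natCast_le_order_mul hx hy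
  | single i k =>
    rw [Finsupp.prod_single_index (by simp), Finsupp.degree_single]
    exact le_order_pow_of_constantCoeff_eq_zero k (ha i)

omit [Finite σ] in
/-- Families that agree up to terms of order two have monomials that agree to one order more. -/
theorem degree_succ_le_order_prod_sub {a b : σ → MvPowerSeries τ ℂ}
    (ha : ∀ i, constantCoeff (a i) = 0) (hb : ∀ i, constantCoeff (b i) = 0)
    (hab : ∀ i, ((2 : ℕ) : ℕ∞) ≤ (a i - b i).order) (d : σ →₀ ℕ) :
    ((d.degree + 1 : ℕ) : ℕ∞) ≤
      ((d.prod fun i k => a i ^ k) - d.prod fun i k => b i ^ k).order := by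
  have key : ∀ {f f' g g' : MvPowerSeries τ ℂ} {m n : ℕ}, ((m + 1 : ℕ) : ℕ∞) ≤ (f - f').order →
      (n : ℕ∞) ≤ g.order → (m : ℕ∞) ≤ f'.order → ((n + 1 : ℕ) : ℕ∞) ≤ (g - g').order →
      ((m + n + 1 : ℕ) : ℕ∞) ≤ (f * g - f' * g').order := by
    intro f f' g g' m n h1 h2 h3 h4
    have : f * g - f' * g' = (f - f') * g + f' * (g - g') := by ring
    rw [this]
    refine natCast_le_order_add ?_ ?_
    · have := natCast_le_order_mul h1 h2
      rwa [show m + 1 + n = m + n + 1 by ring] at this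
    · have := natCast_le_order_mul h3 h4
      rwa [← add_assoc] at this
  induction d using Finsupp.induction_linear with
  | zero => simp
  | add x y hx hy =>
    rw [Finsupp.prod_add_index' (by simp) (by intros; rw [pow_add]),
      Finsupp.prod_add_index' (by simp) (by intros; rw [pow_add]), map_add]
    exact key hx (degree_le_order_prod ha y) (degree_le_order_prod hb x) hy
  | single i k =>
    rw [Finsupp.prod_single_index (by simp), Finsupp.prod_single_index (by simp),
      Finsupp.degree_single]
    induction k with
    | zero => simp
    | succ k ih =>
      rw [pow_succ, pow_succ]
      refine key ih (natCast_le_order_of_constantCoeff (ha i)) ?_ (hab i)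
      exact le_order_pow_of_constantCoeff_eq_zero k (hb i)

/-- The leading part of a substitution depends only on the linear parts of the family. -/
theorem natCast_succ_le_order_subst_sub {a b : σ → MvPowerSeries τ ℂ}
    (ha : ∀ i, constantCoeff (a i) = 0) (hb : ∀ i, constantCoeff (b i) = 0)
    (hab : ∀ i, ((2 : ℕ) : ℕ∞) ≤ (a i - b i).order) {f : MvPowerSeries σ ℂ} {n : ℕ}
    (hf : (n : ℕ∞) ≤ f.order) : ((n + 1 : ℕ) : ℕ∞) ≤ (subst a f - subst b f).order := by
  rw [natCast_le_order_iff]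
  intro e he
  rw [map_sub, coeff_subst (hasSubst_zero ha), coeff_subst (hasSubst_zero hb), sub_eq_zero]
  refine finsum_congr fun d => ?_
  rcases lt_or_ge d.degree n with h | h
  · rw [natCast_le_order_iff.mp hf d h, zero_smul, zero_smul]
  · congr 1
    rw [← sub_eq_zero, ← map_sub]
    exact natCast_le_order_iff.mp (degree_succ_le_order_prod_sub ha hb hab d) e (by omega)

theorem natCast_le_order_subst {a : σ → MvPowerSeries τ ℂ}
    (ha : ∀ i, constantCoeff (a i) = 0) {f : MvPowerSeries σ ℂ} {n : ℕ}
    (hf : (n : ℕ∞) ≤ f.order) : (n : ℕ∞) ≤ (subst a f).order := by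
  rw [natCast_le_order_iff]
  intro e he
  rw [coeff_subst (hasSubst_zero ha), finsum_eq_zero_of_forall_eq_zero]
  intro d
  rcases lt_or_ge d.degree n with h | h
  · rw [natCast_le_order_iff.mp hf d h, zero_smul]
  · rw [natCast_le_order_iff.mp (degree_le_order_prod ha d) e (by omega), smul_zero]

/-- This is the chain rule at the origin: monomials of degree at least two contribute only terms of
order at least two. -/
theorem coeff_single_subst [Fintype σ] {a : σ → MvPowerSeries τ ℂ}
    (ha : ∀ i, constantCoeff (a i) = 0) (f : MvPowerSeries σ ℂ) (k : τ) :
    coeff (Finsupp.single k 1) (subst a f) =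
      ∑ i, coeff (Finsupp.single i 1) f * coeff (Finsupp.single k 1) (a i) := by
  classical
  have hinj : Function.Injective fun i : σ => Finsupp.single i 1 :=
    Finsupp.single_left_injective one_ne_zero
  rw [coeff_subst (hasSubst_zero ha),
    finsum_eq_sum_of_support_subset (s := Finset.univ.image fun i : σ => Finsupp.single i 1),
    Finset.sum_image hinj.injOn]
  · simp [Finsupp.prod_single_index]
  · intro d hd
    rw [Function.mem_support] at hd
    have h1 : d.degree = 1 := by
      by_contra hne
      rcases Nat.lt_or_gt_of_ne hne with h | h
      · have : d = 0 := by
          rw [← Finsupp.degree_eq_zero_iff]; omega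
        subst this
        apply hd
        rw [Finsupp.prod_zero_index, coeff_one, if_neg (by simp), smul_zero]
      · apply hd
        rw [natCast_le_order_iff.mp (degree_le_order_prod ha d) _ (by simpa using h), smul_zero]
    obtain ⟨i, hi⟩ := exists_eq_single_of_degree_eq_one h1
    simp only [Finset.coe_image, Finset.coe_univ, Set.image_univ, Set.mem_range]
    exact ⟨i, hi.symm⟩

theorem constantCoeff_subst_of_zero {a : σ → MvPowerSeries τ ℂ}
    (ha : ∀ i, constantCoeff (a i) = 0) (f : MvPowerSeries σ ℂ) :
    constantCoeff (subst a f) = constantCoeff f := by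
  have h := constantCoeff_subst_eq_zero (hasSubst_zero ha) ha
    (f := f - C (constantCoeff f)) (by simp)
  rw [subst_sub (hasSubst_zero ha), subst_C, map_sub, constantCoeff_C, sub_eq_zero] at h
  exact h

/-- The leading coefficient of a power series along a formal curve. -/
theorem coeff_subst_curve [Fintype σ] [DecidableEq σ] {a : σ → MvPowerSeries Unit ℂ}
    (ha : ∀ i, constantCoeff (a i) = 0) {f : MvPowerSeries σ ℂ} {n : ℕ}
    (hf : (n : ℕ∞) ≤ f.order) :
    coeff (Finsupp.single () n) (subst a f) =
      ∑ d ∈ (Finset.univ : Finset σ).finsuppAntidiag n,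
        coeff d f * ∏ i, coeff (Finsupp.single () 1) (a i) ^ d i := by
  -- The curve is replaced by its tangent line; the error has order at least $n+1$, so the
  -- coefficient of $t^n$ does not see it.
  set b : σ → MvPowerSeries Unit ℂ :=
    fun i => C (coeff (Finsupp.single () 1) (a i)) * X () with hbdef
  have hb : ∀ i, constantCoeff (b i) = 0 := fun i => by simp [hbdef]
  have hab : ∀ i, ((2 : ℕ) : ℕ∞) ≤ (a i - b i).order := by
    intro i
    rw [natCast_le_order_iff]
    intro d hd
    obtain ⟨m, rfl⟩ : ∃ m, d = Finsupp.single () m := ⟨d (), by ext; simp⟩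
    rw [Finsupp.degree_single] at hd
    interval_cases m
    · simp only [Finsupp.single_zero, coeff_zero_eq_constantCoeff_apply, map_sub, ha, hb, sub_zero]
    · rw [map_sub, hbdef, coeff_C_mul, coeff_X, if_pos rfl, mul_one, sub_self]
  have h := natCast_le_order_iff.mp (natCast_succ_le_order_subst_sub ha hb hab hf)
    (Finsupp.single () n) (by simp)
  rw [map_sub, sub_eq_zero] at h
  rw [h, coeff_subst (hasSubst_zero hb)]
  have hprod : ∀ d : σ →₀ ℕ, (d.prod fun i k => b i ^ k) =
      C (∏ i, coeff (Finsupp.single () 1) (a i) ^ d i) * X () ^ d.degree := by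
    intro d
    rw [Finsupp.prod_fintype _ _ (by simp)]
    simp only [hbdef, mul_pow, Finset.prod_mul_distrib, Finset.prod_pow_eq_pow_sum, map_prod,
      map_pow, Finsupp.degree_eq_sum]
  simp only [hprod, coeff_C_mul, coeff_X_pow, smul_eq_mul]
  have hmem : ∀ d : σ →₀ ℕ, d ∈ (Finset.univ : Finset σ).finsuppAntidiag n ↔ d.degree = n := by
    intro d
    rw [Finset.mem_finsuppAntidiag, Finsupp.degree_eq_sum]
    simp
  rw [finsum_eq_sum_of_support_subset (s := (Finset.univ : Finset σ).finsuppAntidiag n)]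
  · refine Finset.sum_congr rfl fun d hd => ?_
    rw [if_pos (by rw [(hmem d).mp hd]), mul_one]
  · intro d hd
    rw [Finset.mem_coe, hmem]
    by_contra hne
    apply hd
    simp only
    rw [if_neg, mul_zero, mul_zero]
    intro h
    exact hne (Finsupp.single_injective () h).symm

end Leading

/-! ### The formal inverse function theorem -/

section Jacobian

variable {σ : Type} [Fintype σ]

omit [Fintype σ] in
theorem FormalMap.ext_apply {F G : FormalMap σ} (h : ∀ i, F.toFun i = G.toFun i) : F = G :=
  FormalMap.ext (funext h)

theorem FormalMap.subst_mul_toFun (F G : FormalMap σ) (f : MvPowerSeries σ ℂ) :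
    subst (F * G).toFun f = subst G.toFun (subst F.toFun f) :=
  (subst_comp_subst_apply F.hasSubst G.hasSubst f).symm

/-- The Jacobian matrix at the origin. -/
def FormalMap.jac (F : FormalMap σ) : Matrix σ σ ℂ :=
  Matrix.of fun i k => coeff (Finsupp.single k 1) (F.toFun i)

omit [Fintype σ] in
theorem FormalMap.jac_apply (F : FormalMap σ) (i k : σ) :
    F.jac i k = coeff (Finsupp.single k 1) (F.toFun i) := rfl

theorem linearPart_eq_jac (F : FormalBihol σ) : linearPart F = (F : FormalMap σ).jac := rfl

theorem FormalMap.jac_mul (F G : FormalMap σ) : (F * G).jac = F.jac * G.jac := by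
  ext i k
  rw [Matrix.mul_apply, FormalMap.jac_apply, FormalMap.mul_toFun, coeff_single_subst G.map_zero]
  rfl

variable [DecidableEq σ]

theorem FormalMap.jac_one : (1 : FormalMap σ).jac = 1 := by
  ext i k
  rw [FormalMap.jac_apply, FormalMap.one_toFun, coeff_X, Matrix.one_apply]
  simp only [Finsupp.single_left_inj one_ne_zero, eq_comm]

omit [DecidableEq σ] in
theorem linearPart_mul (F G : FormalBihol σ) :
    linearPart (F * G) = linearPart F * linearPart G := FormalMap.jac_mul _ _

theorem linearPart_one : linearPart (1 : FormalBihol σ) = 1 := FormalMap.jac_one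

theorem isUnit_linearPart (F : FormalBihol σ) : IsUnit (linearPart F) :=
  ⟨⟨linearPart F, linearPart F⁻¹, by rw [← linearPart_mul, mul_inv_cancel, linearPart_one],
    by rw [← linearPart_mul, inv_mul_cancel, linearPart_one]⟩, rfl⟩

/-- The linear map with a given matrix. -/
def FormalMap.ofMatrix (A : Matrix σ σ ℂ) : FormalMap σ where
  toFun i := ∑ k, C (A i k) * X k
  map_zero i := by simp

omit [DecidableEq σ] in
theorem FormalMap.jac_ofMatrix (A : Matrix σ σ ℂ) : (FormalMap.ofMatrix A).jac = A := by
  classical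
  ext i k
  rw [FormalMap.jac_apply]
  simp only [FormalMap.ofMatrix, map_sum, coeff_C_mul, coeff_X,
    Finsupp.single_left_inj one_ne_zero]
  simp

theorem FormalMap.two_le_order_sub_X {F : FormalMap σ} (hF : F.jac = 1) (i : σ) :
    ((2 : ℕ) : ℕ∞) ≤ (F.toFun i - X i).order := by
  rw [natCast_le_order_iff]
  intro d hd
  rcases Nat.lt_or_ge d.degree 1 with h | h
  · have : d = 0 := by
      rw [← Finsupp.degree_eq_zero_iff]; omega
    subst this
    simp [F.map_zero]
  · obtain ⟨k, rfl⟩ := exists_eq_single_of_degree_eq_one (d := d) (by omega)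
    rw [map_sub]
    change F.jac i k - (1 : FormalMap σ).jac i k = 0
    rw [hF, FormalMap.jac_one, sub_self]

/-- Neumann series: $T=1-F^*$ raises the order, so $\sum_n T^n$ converges coefficientwise and
inverts the pullback $F^*=1-T$. Applied to the coordinates it yields the components of the left
inverse. -/
theorem FormalMap.exists_leftInverse_of_jac_eq_one (F : FormalMap σ) (hF : F.jac = 1) :
    ∃ G : FormalMap σ, G * F = 1 ∧ G.jac = 1 := by
  let T : Module.End ℂ (MvPowerSeries σ ℂ) := 1 - (substAlgHom F.hasSubst).toLinearMap
  have hT : ∀ f, T f = f - subst F.toFun f := fun f => by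
    simp [T]
  have hT1 : ∀ (f : MvPowerSeries σ ℂ) (n : ℕ), (n : ℕ∞) ≤ f.order →
      ((n + 1 : ℕ) : ℕ∞) ≤ (T f).order := by
    intro f n hf
    rw [hT, ← neg_sub, order_neg]
    have := natCast_succ_le_order_subst_sub F.map_zero (b := X) (fun i => constantCoeff_X i)
      (FormalMap.two_le_order_sub_X hF) hf
    rwa [congrFun (subst_self (R := ℂ)) f] at this
  have hTn : ∀ (n : ℕ) (f : MvPowerSeries σ ℂ), (n : ℕ∞) ≤ ((T ^ n) f).order := by
    intro n f
    induction n with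
    | zero => simp
    | succ n ih =>
      rw [pow_succ', Module.End.mul_apply]
      exact hT1 _ _ ih
  let S : ℕ → Module.End ℂ (MvPowerSeries σ ℂ) := fun N => ∑ n ∈ Finset.range N, T ^ n
  have hS : ∀ (f : MvPowerSeries σ ℂ) (d : σ →₀ ℕ) (N : ℕ), d.degree < N →
      coeff d (S N f) = coeff d (S (d.degree + 1) f) := by
    intro f d N hN
    induction N, hN using Nat.le_induction with
    | base => rfl
    | succ N hN ih =>
      have : S (N + 1) = S N + T ^ N := Finset.sum_range_succ _ _
      rw [this, LinearMap.add_apply, map_add, natCast_le_order_iff.mp (hTn N f) d hN, add_zero]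
      exact ih
  -- The coefficient at `d` of the partial sums is constant from $N=\deg d+1$ on; `g i` collects
  -- these limits.
  let g : σ → MvPowerSeries σ ℂ := fun i d => coeff d (S (d.degree + 1) (X i))
  have hg : ∀ i d, coeff d (g i) = coeff d (S (d.degree + 1) (X i)) := fun _ _ => rfl
  have hgS : ∀ i (N : ℕ), (N : ℕ∞) ≤ (g i - S N (X i)).order := by
    intro i N
    rw [natCast_le_order_iff]
    intro d hd
    rw [map_sub, hg, hS _ _ _ hd, sub_self]
  have hsub : ∀ i, subst F.toFun (g i) = X i := by
    intro i
    ext e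
    rw [← sub_eq_zero, ← map_sub]
    have h1 : subst F.toFun (S (e.degree + 1) (X i)) = X i - (T ^ (e.degree + 1)) (X i) := by
      have h2 : (1 - T) * S (e.degree + 1) = 1 - T ^ (e.degree + 1) := mul_neg_geom_sum T _
      have h3 := LinearMap.congr_fun h2 (X i)
      rw [Module.End.mul_apply, LinearMap.sub_apply, hT, LinearMap.sub_apply] at h3
      simpa using h3
    have h4 : subst F.toFun (g i) - X i =
        subst F.toFun (g i - S (e.degree + 1) (X i)) - (T ^ (e.degree + 1)) (X i) := by
      rw [subst_sub F.hasSubst, h1]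
      ring
    rw [h4, map_sub, natCast_le_order_iff.mp (natCast_le_order_subst F.map_zero (hgS i _)) e
      (Nat.lt_succ_self _), natCast_le_order_iff.mp (hTn _ _) e (Nat.lt_succ_self _), sub_zero]
  have hg0 : ∀ i, constantCoeff (g i) = 0 := by
    intro i
    rw [← constantCoeff_subst_of_zero F.map_zero, hsub, constantCoeff_X]
  let G : FormalMap σ := ⟨g, hg0⟩
  have hGF : G * F = 1 := FormalMap.ext_apply hsub
  refine ⟨G, hGF, ?_⟩
  have := congrArg FormalMap.jac hGF
  rwa [FormalMap.jac_mul, hF, mul_one, FormalMap.jac_one] at this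

theorem FormalMap.isUnit_of_jac_eq_one (F : FormalMap σ) (hF : F.jac = 1) : IsUnit F := by
  obtain ⟨G, hGF, hG⟩ := F.exists_leftInverse_of_jac_eq_one hF
  -- `G` has a left inverse as well as the right inverse `F`; the two agree, so `G` inverts `F` on
  -- both sides.
  obtain ⟨H, hHG, -⟩ := G.exists_leftInverse_of_jac_eq_one hG
  have : H = F := left_inv_eq_right_inv hHG hGF
  exact ⟨⟨F, G, by rw [← this, hHG], hGF⟩, rfl⟩

/-- The formal inverse function theorem. -/
theorem FormalMap.isUnit_of_isUnit_jac (F : FormalMap σ) (hF : IsUnit F.jac) : IsUnit F := by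
  obtain ⟨A, hA⟩ := hF
  have h1 : IsUnit (FormalMap.ofMatrix (↑A⁻¹ : Matrix σ σ ℂ) * F) :=
    FormalMap.isUnit_of_jac_eq_one _ (by
      rw [FormalMap.jac_mul, FormalMap.jac_ofMatrix, ← hA, Units.inv_mul])
  have h2 : IsUnit (F * FormalMap.ofMatrix (↑A⁻¹ : Matrix σ σ ℂ)) :=
    FormalMap.isUnit_of_jac_eq_one _ (by
      rw [FormalMap.jac_mul, FormalMap.jac_ofMatrix, ← hA, Units.mul_inv])
  obtain ⟨u, hu⟩ := h1
  obtain ⟨v, hv⟩ := h2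
  have hl : (↑u⁻¹ * FormalMap.ofMatrix (↑A⁻¹ : Matrix σ σ ℂ)) * F = 1 := by
    rw [mul_assoc, ← hu, Units.inv_mul]
  have hr : F * (FormalMap.ofMatrix (↑A⁻¹ : Matrix σ σ ℂ) * ↑v⁻¹) = 1 := by
    rw [← mul_assoc, ← hv, Units.mul_inv]
  exact ⟨⟨F, _, hr, by rw [← left_inv_eq_right_inv hl hr, hl]⟩, rfl⟩

end Jacobian

theorem comps_mul {σ : Type} [Finite σ] (F G : FormalBihol σ) (i : σ) :
    comps (F * G) i = subst (comps G) (comps F i) := rfl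

theorem comps_one {σ : Type} [Finite σ] (i : σ) : comps (1 : FormalBihol σ) i = X i := rfl

theorem hasSubst_comps {σ : Type} [Finite σ] (F : FormalBihol σ) : HasSubst (comps F) :=
  FormalMap.hasSubst _

theorem constantCoeff_comps {σ : Type} [Finite σ] (F : FormalBihol σ) (i : σ) :
    constantCoeff (comps F i) = 0 := FormalMap.map_zero _ i

theorem subst_comps_mul {σ : Type} [Finite σ] (F G : FormalBihol σ) (f : MvPowerSeries σ ℂ) :
    subst (comps (F * G)) f = subst (comps G) (subst (comps F) f) :=
  (subst_comp_subst_apply (hasSubst_comps F) (hasSubst_comps G) f).symm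

theorem subst_comps_one {σ : Type} [Finite σ] (f : MvPowerSeries σ ℂ) :
    subst (comps (1 : FormalBihol σ)) f = f :=
  congrFun (subst_self (R := ℂ)) f

theorem bihol_ext {σ : Type} [Finite σ] {F G : FormalBihol σ}
    (h : ∀ i, comps F i = comps G i) : F = G :=
  Units.ext (FormalMap.ext_apply h)

/-! ### Linearizing finite groups by averaging -/

section Average

variable {σ : Type} [Fintype σ]

/-- The linear part of a power series as a vector of coefficients. -/
def linCoeff (f : MvPowerSeries σ ℂ) : σ → ℂ := fun k => coeff (Finsupp.single k 1) f

/-- The linear form with given coefficients. -/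
def linForm (a : σ → ℂ) : MvPowerSeries σ ℂ := ∑ k, a k • X k

theorem constantCoeff_linForm (a : σ → ℂ) : constantCoeff (linForm a) = 0 := by
  simp [linForm]

theorem linCoeff_linForm (a : σ → ℂ) : linCoeff (linForm a) = a := by
  classical
  ext k
  simp only [linCoeff, linForm, map_sum, coeff_smul, coeff_X,
    Finsupp.single_left_inj one_ne_zero]
  simp

theorem linCoeff_comps (F : FormalBihol σ) (i : σ) : linCoeff (comps F i) = linearPart F i := rfl

theorem linCoeff_subst (F : FormalBihol σ) (f : MvPowerSeries σ ℂ) :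
    linCoeff (subst (comps F) f) = Matrix.vecMul (linCoeff f) (linearPart F) := by
  ext k
  rw [linCoeff, coeff_single_subst (constantCoeff_comps F)]
  rfl

variable {H : Type} [Group H] [Fintype H]

/-- The component of `f` on which the finite group `H` acts by the character `χ`. -/
def average (ψ : H →* FormalBihol σ) (χ : H →* ℂ) (f : MvPowerSeries σ ℂ) : MvPowerSeries σ ℂ :=
  (Fintype.card H : ℂ)⁻¹ • ∑ h, (χ h)⁻¹ • subst (comps (ψ h)) f

omit [Fintype H] in
theorem character_ne_zero (χ : H →* ℂ) (h : H) : χ h ≠ 0 := by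
  intro h0
  have := χ.map_mul h h⁻¹
  rw [mul_inv_cancel, map_one, h0, zero_mul] at this
  exact one_ne_zero this

theorem subst_sum {ι τ ν : Type} {a : τ → MvPowerSeries ν ℂ} (ha : HasSubst a) (s : Finset ι)
    (f : ι → MvPowerSeries τ ℂ) : subst a (∑ i ∈ s, f i) = ∑ i ∈ s, subst a (f i) := by
  simp only [← substAlgHom_apply ha, map_sum]

theorem subst_average (ψ : H →* FormalBihol σ) (χ : H →* ℂ) (f : MvPowerSeries σ ℂ) (k : H) :
    subst (comps (ψ k)) (average ψ χ f) = χ k • average ψ χ f := by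
  rw [average, subst_smul (hasSubst_comps _), smul_comm]
  congr 1
  rw [subst_sum (hasSubst_comps _), Finset.smul_sum]
  -- Substituting `ψ k` after `ψ h` is substituting `ψ (h * k)`, so the sum is reindexed by
  -- $h\mapsto hk$ and the factor $\chi(k)$ comes out.
  refine Fintype.sum_equiv (Equiv.mulRight k) _ _ fun h => ?_
  rw [subst_smul (hasSubst_comps _), ← subst_comps_mul, ← map_mul, smul_smul]
  change _ = (χ k * (χ (h * k))⁻¹) • _
  rw [map_mul χ, mul_inv, mul_comm (χ h)⁻¹, mul_inv_cancel_left₀ (character_ne_zero χ k)]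
  rfl

theorem constantCoeff_average (ψ : H →* FormalBihol σ) (χ : H →* ℂ) {f : MvPowerSeries σ ℂ}
    (hf : constantCoeff f = 0) : constantCoeff (average ψ χ f) = 0 := by
  rw [average, constantCoeff_smul, map_sum, Finset.sum_eq_zero, smul_zero]
  intro h _
  rw [constantCoeff_smul, constantCoeff_subst_of_zero (constantCoeff_comps _), hf, smul_zero]

theorem linCoeff_average (ψ : H →* FormalBihol σ) (χ : H →* ℂ) (f : MvPowerSeries σ ℂ) :
    linCoeff (average ψ χ f) = (Fintype.card H : ℂ)⁻¹ • ∑ h, (χ h)⁻¹ •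
      Matrix.vecMul (linCoeff f) (linearPart (ψ h)) := by
  ext k
  simp only [← linCoeff_subst]
  simp [linCoeff, average]

theorem card_inv_smul_sum_const {V : Type*} [AddCommGroup V] [Module ℂ V] (v : V) :
    (Fintype.card H : ℂ)⁻¹ • ∑ _h : H, v = v := by
  rw [Finset.sum_const, Finset.card_univ, ← Nat.cast_smul_eq_nsmul ℂ, smul_smul,
    inv_mul_cancel₀ (by exact_mod_cast Fintype.card_ne_zero), one_smul]

variable [DecidableEq σ]

/-- A finite group of formal maps whose linear parts are simultaneously diagonal in some linear
coordinates is simultaneously diagonal in some formal coordinates. -/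
theorem exists_diagonalizing_coordinates (ψ : H →* FormalBihol σ) (χ : σ → H →* ℂ)
    {A : Matrix σ σ ℂ} (hA : IsUnit A)
    (h : ∀ k, A * linearPart (ψ k) = Matrix.diagonal (fun i => χ i k) * A) :
    ∃ U : FormalBihol σ, linearPart U = A ∧
      ∀ i k, subst (comps (ψ k)) (comps U i) = χ i k • comps U i := by
  let F : FormalMap σ := ⟨fun i => average ψ (χ i) (linForm (A i)),
    fun i => constantCoeff_average _ _ (constantCoeff_linForm _)⟩
  have hF : F.jac = A := by
    ext i j
    change linCoeff (average ψ (χ i) (linForm (A i))) j = _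
    rw [linCoeff_average, linCoeff_linForm]
    -- The rows of `A` are left eigenvectors of the linear parts with eigenvalues $\chi_i$, so every
    -- term of the average has the same linear part.
    have : ∀ k, (χ i k)⁻¹ • Matrix.vecMul (A i) (linearPart (ψ k)) = A i := by
      intro k
      have h1 : Matrix.vecMul (A i) (linearPart (ψ k)) = χ i k • A i := by
        ext l
        have := congrFun (congrFun (h k) i) l
        rwa [Matrix.diagonal_mul] at this
      rw [h1, smul_smul, inv_mul_cancel₀ (character_ne_zero _ _), one_smul]
    rw [Finset.sum_congr rfl fun k _ => this k, card_inv_smul_sum_const]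
  obtain ⟨U, hU⟩ := F.isUnit_of_isUnit_jac (hF ▸ hA)
  refine ⟨U, ?_, fun i k => ?_⟩
  · rw [linearPart_eq_jac, hU, hF]
  · have : comps U i = average ψ (χ i) (linForm (A i)) := by rw [comps, hU]
    rw [this, subst_average]

/-- The block of the linear part that acts on the `w`-coordinates. -/
def wBlock {p : ℕ} (F : FormalBihol (ZW p)) : Matrix (Fin p) (Fin p) ℂ :=
  (linearPart F).toBlocks₂₂

theorem linearPart_inl {p : ℕ} {F : FormalBihol (ZW p)}
    (hF : ∀ i, comps F (Sum.inl i) = X (Sum.inl i)) (i : Fin p) (k : ZW p) :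
    linearPart F (Sum.inl i) k = if Sum.inl i = k then 1 else 0 := by
  have : linearPart F (Sum.inl i) k = linearPart 1 (Sum.inl i) k := by
    change coeff _ (comps F _) = coeff _ (comps 1 _)
    rw [hF, comps_one]
  rw [this, linearPart_one, Matrix.one_apply]

theorem linearPart_eq_fromBlocks {p : ℕ} {F : FormalBihol (ZW p)}
    (hF : ∀ i, comps F (Sum.inl i) = X (Sum.inl i)) :
    linearPart F = Matrix.fromBlocks 1 0 (linearPart F).toBlocks₂₁ (wBlock F) := by
  conv_lhs => rw [← Matrix.fromBlocks_toBlocks (linearPart F)]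
  congr 1
  · ext i j
    rw [Matrix.toBlocks₁₁, Matrix.of_apply, linearPart_inl hF, Matrix.one_apply]
    simp
  · ext i j
    rw [Matrix.toBlocks₁₂, Matrix.of_apply, linearPart_inl hF]
    simp

theorem isUnit_wBlock {p : ℕ} {F : FormalBihol (ZW p)}
    (hF : ∀ i, comps F (Sum.inl i) = X (Sum.inl i)) : IsUnit (wBlock F) := by
  have h := isUnit_linearPart F
  rw [linearPart_eq_fromBlocks hF, Matrix.isUnit_fromBlocks_zero₁₂] at h
  exact h.2

theorem wBlock_mul {p : ℕ} {F G : FormalBihol (ZW p)}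
    (hG : ∀ i, comps G (Sum.inl i) = X (Sum.inl i)) :
    wBlock (F * G) = wBlock F * wBlock G := by
  rw [wBlock, linearPart_mul, linearPart_eq_fromBlocks hG,
    ← Matrix.fromBlocks_toBlocks (linearPart F), Matrix.fromBlocks_multiply,
    Matrix.toBlocks_fromBlocks₂₂, mul_zero, zero_add]
  rfl

theorem wBlock_one {p : ℕ} : wBlock (1 : FormalBihol (ZW p)) = 1 := by
  rw [wBlock, linearPart_one, ← Matrix.fromBlocks_one, Matrix.toBlocks_fromBlocks₂₂]

/-- Relative version of `exists_diagonalizing_coordinates` that keeps the `z`-coordinates. -/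
theorem exists_relative_coordinates {p : ℕ} (ψ : H →* FormalBihol (ZW p))
    (χ : Fin p → H →* ℂ)
    {A : Matrix (Fin p) (Fin p) ℂ} (hA : IsUnit A)
    (h : ∀ k, A * wBlock (ψ k) = Matrix.diagonal (fun i => χ i k) * A) :
    ∃ U : FormalBihol (ZW p), (∀ i, comps U (Sum.inl i) = X (Sum.inl i)) ∧
      ∀ i k, subst (comps (ψ k)) (comps U (Sum.inr i)) = χ i k • comps U (Sum.inr i) := by
  let f : Fin p → MvPowerSeries (ZW p) ℂ := fun i =>
    average ψ (χ i) (linForm (Sum.elim 0 (A i)))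
  let F : FormalMap (ZW p) := ⟨Sum.elim (fun i => X (Sum.inl i)) f, by
    rintro (i | i)
    · exact constantCoeff_X _
    · exact constantCoeff_average _ _ (constantCoeff_linForm _)⟩
  have hF : F.jac = Matrix.fromBlocks 1 0 F.jac.toBlocks₂₁ A := by
    conv_lhs => rw [← Matrix.fromBlocks_toBlocks F.jac]
    have hinl : ∀ i k, F.jac (Sum.inl i) k = (1 : Matrix (ZW p) (ZW p) ℂ) (Sum.inl i) k := by
      intro i k
      rw [← FormalMap.jac_one]
      rfl
    congr 1
    · ext i j
      rw [Matrix.toBlocks₁₁, Matrix.of_apply, hinl, Matrix.one_apply, Matrix.one_apply]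
      simp
    · ext i j
      rw [Matrix.toBlocks₁₂, Matrix.of_apply, hinl, Matrix.one_apply]
      simp
    · ext i j
      change linCoeff (average ψ (χ i) (linForm (Sum.elim 0 (A i)))) (Sum.inr j) = _
      rw [linCoeff_average, linCoeff_linForm]
      have : ∀ k, ((χ i k)⁻¹ • Matrix.vecMul (Sum.elim 0 (A i)) (linearPart (ψ k)))
          (Sum.inr j) = A i j := by
        intro k
        have h1 : Matrix.vecMul (Sum.elim 0 (A i)) (linearPart (ψ k)) (Sum.inr j) =
            χ i k * A i j := by
          have := congrFun (congrFun (h k) i) j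
          rw [Matrix.diagonal_mul] at this
          rw [← this, Matrix.mul_apply, Matrix.vecMul, dotProduct, Fintype.sum_sum_type]
          simp [wBlock, Matrix.toBlocks₂₂]
        rw [Pi.smul_apply, h1, smul_eq_mul, inv_mul_cancel_left₀ (character_ne_zero _ _)]
      rw [Pi.smul_apply, Finset.sum_apply, Finset.sum_congr rfl fun k _ => this k,
        card_inv_smul_sum_const]
  -- The Jacobian is block triangular, so the lower left block, which the averaging does not
  -- control, is irrelevant.
  obtain ⟨U, hU⟩ := F.isUnit_of_isUnit_jac (by
    rw [hF, Matrix.isUnit_fromBlocks_zero₁₂]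
    exact ⟨isUnit_one, hA⟩)
  have hU' : comps U = F.toFun := by rw [comps, hU]
  refine ⟨U, fun i => by rw [hU']; rfl, fun i k => ?_⟩
  rw [hU']
  exact subst_average _ _ _ _

end Average

/-! ### Diagonalization of matrices of finite order -/

section Diagonalization

theorem isSemisimple_of_pow_eq_one {V : Type*} [AddCommGroup V] [Module ℂ V]
    {f : Module.End ℂ V} {m : ℕ} (hm : m ≠ 0) (hf : f ^ m = 1) : f.IsSemisimple := by
  refine Module.End.isSemisimple_of_squarefree_aeval_eq_zero (p := Polynomial.X ^ m - 1)
    (Polynomial.X_pow_sub_one_separable_iff.mpr (by exact_mod_cast hm)).squarefree ?_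
  simp [hf]

theorem iSup_eigenspace_eq_top_of_pow_eq_one {V : Type*} [AddCommGroup V] [Module ℂ V]
    [FiniteDimensional ℂ V] {f : Module.End ℂ V} {m : ℕ} (hm : m ≠ 0) (hf : f ^ m = 1) :
    ⨆ μ, f.eigenspace μ = ⊤ := by
  rw [← Module.End.iSup_maxGenEigenspace_eq_top f]
  have := (isSemisimple_of_pow_eq_one hm hf).isFinitelySemisimple
  simp only [this.maxGenEigenspace_eq_eigenspace]

/-- A matrix of finite order all of whose eigenvalues are `±1` is an involution. -/
theorem mul_self_eq_one_of_pow_eq_one {n : Type} [Fintype n] [DecidableEq n] {B : Matrix n n ℂ}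
    {m : ℕ} (hm : m ≠ 0) (hB : B ^ m = 1)
    (h : ∀ (v : n → ℂ) (μ : ℂ), v ≠ 0 → B.mulVec v = μ • v → μ ^ 2 = 1) : B * B = 1 := by
  set f : Module.End ℂ (n → ℂ) := Matrix.toLin' B with hfdef
  have hf : f ^ m = 1 := by
    rw [hfdef, ← Matrix.toLin'_pow, hB, Matrix.toLin'_one]
    rfl
  have hff : f * f = 1 := by
    have htop : (⊤ : Submodule ℂ (n → ℂ)) ≤ LinearMap.eqLocus (f * f) 1 := by
      rw [← iSup_eigenspace_eq_top_of_pow_eq_one hm hf, iSup_le_iff]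
      intro μ v hv
      rw [Module.End.mem_eigenspace_iff] at hv
      rw [LinearMap.mem_eqLocus, Module.End.mul_apply, hv, map_smul, hv, smul_smul,
        Module.End.one_apply]
      by_cases hv0 : v = 0
      · rw [hv0, smul_zero]
      · rw [← pow_two, h v μ hv0 (by rw [← Matrix.toLin'_apply]; exact hv), one_smul]
    exact LinearMap.ext fun v => LinearMap.mem_eqLocus.mp (htop Submodule.mem_top)
  apply Matrix.toLin'.injective
  rw [Matrix.toLin'_mul, Matrix.toLin'_one]
  exact hff

/-- Simultaneous diagonalization of a representation of a group of exponent two. -/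
theorem exists_simultaneous_diagonalization {H : Type} [Group H] (hH : ∀ h : H, h * h = 1)
    {n : Type} [Fintype n] [DecidableEq n] (L : H →* Matrix n n ℂ) :
    ∃ (A : Matrix n n ℂ) (χ : n → H →* ℂ), IsUnit A ∧
      ∀ h, A * L h = Matrix.diagonal (fun i => χ i h) * A := by
  have hinv : ∀ h : H, h⁻¹ = h := fun h => inv_eq_of_mul_eq_one_left (hH h)
  have hcomm : ∀ h k : H, h * k = k * h := fun h k => by
    rw [← hinv (h * k), mul_inv_rev, hinv, hinv]
  -- The rows of the sought `A` are common left eigenvectors, hence the action on row vectors. It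
  -- reverses products, which is harmless as a group of exponent two is commutative.
  let f : H → Module.End ℂ (n → ℂ) := fun h => (L h).vecMulLinear
  have hf : ∀ h v, f h v = Matrix.vecMul v (L h) := fun _ _ => rfl
  have hff : ∀ h k, f h * f k = f (k * h) := by
    intro h k
    refine LinearMap.ext fun v => ?_
    rw [Module.End.mul_apply, hf, hf, hf, Matrix.vecMul_vecMul, map_mul]
  have hf1 : f 1 = 1 := by
    refine LinearMap.ext fun v => ?_
    rw [hf, map_one, Matrix.vecMul_one, Module.End.one_apply]
  have hsq : ∀ h, f h ^ 2 = 1 := fun h => by rw [pow_two, hff, hH, hf1]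
  let S : Set (n → ℂ) := {v | ∀ h, ∃ c : ℂ, f h v = c • v}
  have hS : Submodule.span ℂ S = ⊤ := by
    rw [eq_top_iff, ← Module.End.iSup_iInf_maxGenEigenspace_eq_top_of_iSup_maxGenEigenspace_eq_top_of_commute
      f (fun h k _ => show f h * f k = f k * f h by rw [hff, hff, hcomm])
      (fun h => Module.End.iSup_maxGenEigenspace_eq_top _), iSup_le_iff]
    intro χ v hv
    apply Submodule.subset_span
    intro h
    refine ⟨χ h, ?_⟩
    have := (Submodule.mem_iInf _).mp hv h
    rwa [(isSemisimple_of_pow_eq_one two_ne_zero (hsq h)).isFinitelySemisimple.maxGenEigenspace_eq_eigenspace,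
      Module.End.mem_eigenspace_iff] at this
  -- The common eigenvectors span, so a basis can be chosen among them; each basis vector carries a
  -- character.
  obtain ⟨b, hbS, hbspan, hbli⟩ := exists_linearIndependent ℂ S
  let B : Module.Basis b ℂ (n → ℂ) := Module.Basis.mk hbli (by
    rw [Subtype.range_coe, hbspan, hS])
  let e : b ≃ n := B.indexEquiv (Pi.basisFun ℂ n)
  let v : n → n → ℂ := fun i => (e.symm i : n → ℂ)
  have hvli : LinearIndependent ℂ v := hbli.comp _ e.symm.injective
  have hv : ∀ i h, ∃ c : ℂ, f h (v i) = c • v i := fun i => hbS (e.symm i).2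
  choose c hc using hv
  have hcinj : ∀ i (x y : ℂ), x • v i = y • v i → x = y :=
    fun i x y hxy => smul_left_injective ℂ (hvli.ne_zero i) hxy
  let χ : n → H →* ℂ := fun i =>
    { toFun := c i
      map_one' := hcinj i _ _ (by rw [← hc, hf1, one_smul]; rfl)
      map_mul' := fun h k => hcinj i _ _ (by
        rw [← hc, ← hff, Module.End.mul_apply, hc, map_smul, hc, smul_smul]) }
  refine ⟨Matrix.of v, χ, Matrix.linearIndependent_rows_iff_isUnit.mp hvli, fun h => ?_⟩
  ext i j
  rw [Matrix.diagonal_mul]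
  exact congrFun (hc i h) j

end Diagonalization

/-! ### The group of sign changes -/

section Flip

variable {p : ℕ}

/-- The sign `s k` as a complex number. -/
def sgn (s : Fin p → ℤˣ) (k : Fin p) : ℂ := ((s k : ℤ) : ℂ)

theorem sgn_mul (s t : Fin p → ℤˣ) (k : Fin p) : sgn (s * t) k = sgn s k * sgn t k := by
  simp [sgn]

theorem sgn_eq_one_or (s : Fin p → ℤˣ) (k : Fin p) : sgn s k = 1 ∨ sgn s k = -1 := by
  rcases Int.units_eq_one_or (s k) with h | h <;> simp [sgn, h]

theorem sgn_injective : Function.Injective (sgn : (Fin p → ℤˣ) → Fin p → ℂ) := by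
  intro s t h
  ext k
  have := congrFun h k
  simpa [sgn] using this

/-- The sign change `(z', w') ↦ (z', s w')`. -/
def flipMap (s : Fin p → ℤˣ) : FormalMap (ZW p) where
  toFun := Sum.elim (fun i => X (Sum.inl i)) fun k => sgn s k • X (Sum.inr k)
  map_zero := by rintro (i | k) <;> simp

theorem flipMap_mul (s t : Fin p → ℤˣ) : flipMap (s * t) = flipMap s * flipMap t := by
  refine FormalMap.ext_apply ?_
  rintro (i | k)
  · change X (Sum.inl i) = subst (flipMap t).toFun (X (Sum.inl i) : MvPowerSeries (ZW p) ℂ)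
    rw [subst_X (flipMap t).hasSubst]
    rfl
  · refine Eq.trans ?_ (subst_smul (flipMap t).hasSubst (sgn s k)
      (X (Sum.inr k) : MvPowerSeries (ZW p) ℂ)).symm
    rw [subst_X (flipMap t).hasSubst]
    change sgn (s * t) k • _ = sgn s k • sgn t k • _
    rw [smul_smul, sgn_mul]

theorem flipMap_one : flipMap (1 : Fin p → ℤˣ) = 1 := by
  refine FormalMap.ext_apply ?_
  rintro (i | k)
  · rfl
  · change sgn 1 k • X (Sum.inr k) = X (Sum.inr k)
    simp [sgn]

theorem signs_mul_self (s : Fin p → ℤˣ) : s * s = 1 :=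
  funext fun k => Int.units_mul_self (s k)

/-- The group of all sign changes in the `w`-coordinates. -/
def flip : (Fin p → ℤˣ) →* FormalBihol (ZW p) where
  toFun s := ⟨flipMap s, flipMap s, by rw [← flipMap_mul, signs_mul_self, flipMap_one],
    by rw [← flipMap_mul, signs_mul_self, flipMap_one]⟩
  map_one' := Units.ext flipMap_one
  map_mul' s t := Units.ext (flipMap_mul s t)

theorem comps_flip_inl (s : Fin p → ℤˣ) (i : Fin p) :
    comps (flip s) (Sum.inl i) = X (Sum.inl i) := rfl

theorem comps_flip_inr (s : Fin p → ℤˣ) (k : Fin p) :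
    comps (flip s) (Sum.inr k) = sgn s k • X (Sum.inr k) := rfl

theorem linearPart_flip (s : Fin p → ℤˣ) :
    linearPart (flip s) = Matrix.diagonal (Sum.elim 1 (sgn s)) := by
  ext i k
  change coeff _ (comps (flip s) i) = _
  rw [Matrix.diagonal_apply]
  rcases i with i | i
  · rw [comps_flip_inl, coeff_X]
    simp [Finsupp.single_left_inj one_ne_zero, eq_comm]
  · rw [comps_flip_inr, coeff_smul, coeff_X]
    simp [Finsupp.single_left_inj one_ne_zero, eq_comm]

theorem flip_injective : Function.Injective (flip : (Fin p → ℤˣ) → FormalBihol (ZW p)) := by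
  intro s t h
  apply sgn_injective
  have := congrArg linearPart h
  rw [linearPart_flip, linearPart_flip] at this
  have := Matrix.diagonal_injective this
  exact funext fun k => congrFun this (Sum.inr k)

theorem comps_flip_mul_inl (s : Fin p → ℤˣ) (U : FormalBihol (ZW p)) (i : Fin p) :
    comps (flip s * U) (Sum.inl i) = comps U (Sum.inl i) := by
  rw [comps_mul, comps_flip_inl, subst_X (hasSubst_comps U)]

theorem comps_flip_mul_inr (s : Fin p → ℤˣ) (U : FormalBihol (ZW p)) (k : Fin p) :
    comps (flip s * U) (Sum.inr k) = sgn s k • comps U (Sum.inr k) := by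
  rw [comps_mul, comps_flip_inr, subst_smul (hasSubst_comps U), subst_X (hasSubst_comps U)]

end Flip

/-! ### The deck group under condition D -/

namespace FormalSubmanifold

variable {p : ℕ}

theorem eval_q (M : FormalSubmanifold p) (j : Fin p) (w : Fin p → ℂ) :
    MvPolynomial.eval w (M.q j) = ∑ d ∈ (Finset.univ : Finset (Fin p)).finsuppAntidiag 2,
      coeff (Finsupp.mapDomain Sum.inr d) (M.E j) * ∏ i, w i ^ d i := by
  rw [q, map_sum]
  refine Finset.sum_congr rfl fun d _ => ?_
  rw [MvPolynomial.eval_monomial, Finsupp.prod_fintype _ _ (by simp)]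

theorem eval_smul_q (M : FormalSubmanifold p) (j : Fin p) (μ : ℂ) (w : Fin p → ℂ) :
    MvPolynomial.eval (μ • w) (M.q j) = μ ^ 2 * MvPolynomial.eval w (M.q j) := by
  rw [eval_q, eval_q, Finset.mul_sum]
  refine Finset.sum_congr rfl fun d hd => ?_
  have h2 : ∑ i, d i = 2 := (Finset.mem_finsuppAntidiag.mp hd).1
  simp only [Pi.smul_apply, smul_eq_mul, mul_pow, Finset.prod_mul_distrib,
    Finset.prod_pow_eq_pow_sum, h2]
  ring

/-- The quadratic form `q` is the leading term of `E` along formal curves tangent to `z' = 0`. -/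
theorem coeff_subst_E (M : FormalSubmanifold p) (j : Fin p)
    {a : ZW p → MvPowerSeries Unit ℂ} (ha : ∀ i, constantCoeff (a i) = 0) {w : Fin p → ℂ}
    (hl : ∀ i, coeff (Finsupp.single () 1) (a (Sum.inl i)) = 0)
    (hr : ∀ k, coeff (Finsupp.single () 1) (a (Sum.inr k)) = w k) :
    coeff (Finsupp.single () 2) (subst a (M.E j)) = MvPolynomial.eval w (M.q j) := by
  have h2 : ((2 : ℕ) : ℕ∞) ≤ (M.E j).order := M.two_le_order j
  rw [coeff_subst_curve ha h2, eval_q]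
  symm
  refine Finset.sum_of_injOn (Finsupp.mapDomain Sum.inr)
    (Finsupp.mapDomain_injective Sum.inr_injective).injOn ?_ ?_ ?_
  · intro d hd
    rw [Finset.mem_coe, Finset.mem_finsuppAntidiag] at hd ⊢
    refine ⟨?_, Finset.subset_univ _⟩
    rw [← hd.1, Fintype.sum_sum_type]
    simp only [Finsupp.mapDomain_apply Sum.inr_injective]
    rw [Finset.sum_eq_zero (s := Finset.univ) (f := fun i => Finsupp.mapDomain Sum.inr d (Sum.inl i)),
      zero_add]
    · intro i _
      exact Finsupp.mapDomain_of_notMem_range _ _ (by simp)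
  · intro d _ hd
    -- A monomial that is not in $w'$ alone contains some $z_i$, whose velocity along the curve is
    -- zero.
    obtain ⟨i, hi⟩ : ∃ i, d (Sum.inl i) ≠ 0 := by
      by_contra! hcon
      refine hd ⟨d.comapDomain Sum.inr Sum.inr_injective.injOn, ?_, ?_⟩
      · rename_i hmem
        rw [Finset.mem_finsuppAntidiag] at hmem
        rw [Finset.mem_coe, Finset.mem_finsuppAntidiag]
        refine ⟨?_, Finset.subset_univ _⟩
        rw [← hmem.1, Fintype.sum_sum_type, Finset.sum_eq_zero fun i _ => hcon i, zero_add]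
        rfl
      · refine Finsupp.mapDomain_comapDomain _ Sum.inr_injective _ ?_
        rintro (i | k) hk
        · exact absurd (hcon i) (by simpa using hk)
        · exact ⟨k, rfl⟩
    rw [Finset.prod_eq_zero (Finset.mem_univ (Sum.inl i)), mul_zero]
    rw [hl, zero_pow hi]
  · intro d _
    congr 1
    rw [Fintype.prod_sum_type, Finset.prod_eq_one (s := Finset.univ)
      (f := fun i => coeff (Finsupp.single () 1) (a (Sum.inl i)) ^
        Finsupp.mapDomain Sum.inr d (Sum.inl i)), one_mul]
    · refine Finset.prod_congr rfl fun k _ => ?_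
      rw [hr, Finsupp.mapDomain_apply Sum.inr_injective]
    · intro i _
      rw [Finsupp.mapDomain_of_notMem_range _ _ (by simp), pow_zero]

/-- The straight line through `(0, w)`. -/
def line (w : Fin p → ℂ) : ZW p → MvPowerSeries Unit ℂ :=
  Sum.elim (fun _ => 0) fun k => w k • X ()

theorem constantCoeff_line (w : Fin p → ℂ) (i : ZW p) : constantCoeff (line w i) = 0 := by
  rcases i with i | k <;> simp [line]

theorem coeff_line_inl (w : Fin p → ℂ) (i : Fin p) :
    coeff (Finsupp.single () 1) (line w (Sum.inl i)) = 0 := by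
  simp [line]

theorem coeff_line_inr (w : Fin p → ℂ) (k : Fin p) :
    coeff (Finsupp.single () 1) (line w (Sum.inr k)) = w k := by
  simp [line, coeff_X]

theorem hasSubst_line (w : Fin p → ℂ) : HasSubst (line w) :=
  hasSubst_of_constantCoeff_zero (constantCoeff_line w)

theorem coeff_subst_line_comps_inr (F : FormalBihol (ZW p)) (w : Fin p → ℂ) (k : Fin p) :
    coeff (Finsupp.single () 1) (subst (line w) (comps F (Sum.inr k))) =
      (wBlock F).mulVec w k := by
  rw [coeff_single_subst (constantCoeff_line w), Fintype.sum_sum_type, Finset.sum_eq_zero, zero_add]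
  · simp only [coeff_line_inr]
    rfl
  · intro i _
    rw [coeff_line_inl, mul_zero]

/-- Since $\tau$ keeps $z'$, it maps the line through $(0,w)$ to a curve in $z'=0$ with velocity
given by the $w'$-block. Comparing the $t^2$-coefficients of $E\circ\tau=E$ along the line gives the
invariance. -/
theorem eval_q_wBlock (M : FormalSubmanifold p) {τ : FormalBihol (ZW p)} (hτ : τ ∈ M.deck)
    (j : Fin p) (w : Fin p → ℂ) :
    MvPolynomial.eval ((wBlock τ).mulVec w) (M.q j) = MvPolynomial.eval w (M.q j) := by
  rw [← M.coeff_subst_E j (constantCoeff_line w) (coeff_line_inl w) (coeff_line_inr w),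
    ← M.coeff_subst_E j (a := fun i => subst (line w) (comps τ i))
      (fun i => by rw [constantCoeff_subst_of_zero (constantCoeff_line w), constantCoeff_comps])
      (fun i => by rw [hτ.1, subst_X (hasSubst_line w), coeff_line_inl])
      (fun k => coeff_subst_line_comps_inr τ w k),
    ← subst_comp_subst_apply (hasSubst_comps τ) (hasSubst_line w), hτ.2]

/-- The action of the deck transformations on the `w`-directions. -/
def wBlockHom (M : FormalSubmanifold p) : M.deck →* Matrix (Fin p) (Fin p) ℂ where
  toFun τ := wBlock (τ : FormalBihol (ZW p))
  map_one' := wBlock_one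
  map_mul' _ τ := wBlock_mul τ.2.1

/-- A finite group of maps that keep $z'$ and have trivial $w'$-blocks is trivial: averaging with
trivial characters produces invariant coordinates $U$, and $U\circ h=U$ forces $h=1$. -/
theorem wBlockHom_injective (M : FormalSubmanifold p) [Finite M.deck] :
    Function.Injective M.wBlockHom := by
  rw [← MonoidHom.ker_eq_bot_iff, Subgroup.eq_bot_iff_forall]
  intro h hh
  have : Fintype M.wBlockHom.ker := Fintype.ofFinite _
  obtain ⟨U, hU, hU'⟩ := exists_relative_coordinates (M.deck.subtype.comp M.wBlockHom.ker.subtype)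
    (fun _ => 1) (A := 1) isUnit_one (fun k => by
      have h1 : wBlock ((M.deck.subtype.comp M.wBlockHom.ker.subtype) k) = 1 := k.2
      rw [h1]
      simp)
  have hUh : U * (h : FormalBihol (ZW p)) = U := by
    refine bihol_ext ?_
    rintro (i | k)
    · rw [comps_mul, hU, subst_X (hasSubst_comps _), h.2.1]
    · rw [comps_mul]
      have := hU' k ⟨h, hh⟩
      rwa [MonoidHom.one_apply, one_smul] at this
  exact Subtype.ext (mul_eq_left.mp hUh)

/-- By faithfulness it suffices to look at the $w'$-block. By condition B some $q_j$ is nonzero at a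
given eigenvector, and its invariance and homogeneity give $\mu^2=1$. -/
theorem deck_mul_self (M : FormalSubmanifold p) (hM : M.ConditionB) [Finite M.deck]
    (τ : M.deck) : τ * τ = 1 := by
  apply M.wBlockHom_injective
  rw [map_mul, map_one]
  refine mul_self_eq_one_of_pow_eq_one (orderOf_pos τ).ne' ?_ ?_
  · rw [← map_pow, pow_orderOf_eq_one, map_one]
  · intro v μ hv hμ
    obtain ⟨j, hj⟩ : ∃ j, MvPolynomial.eval v (M.q j) ≠ 0 := by
      by_contra! hcon
      exact hv (hM v hcon)
    have h := M.eval_q_wBlock τ.2 j v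
    change (wBlock (τ : FormalBihol (ZW p))).mulVec v = _ at hμ
    rw [hμ, eval_smul_q] at h
    exact mul_right_cancel₀ hj (by rw [h, one_mul])

/-- In suitable coordinates that keep `z'`, the deck transformations are all the sign changes. -/
theorem exists_normalizing_coordinates (M : FormalSubmanifold p) (hM : M.ConditionD) :
    ∃ U : FormalBihol (ZW p), (∀ i, comps U (Sum.inl i) = X (Sum.inl i)) ∧
      ∀ g, g ∈ M.deck ↔ ∃ s, g = U⁻¹ * flip s * U := by
  have hcard := hM.2
  have hfin : Finite M.deck := Nat.finite_of_card_ne_zero (by rw [hcard]; positivity)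
  have : Fintype M.deck := Fintype.ofFinite _
  have hsq := M.deck_mul_self hM.1
  obtain ⟨A, χ, hA, hAχ⟩ := exists_simultaneous_diagonalization hsq M.wBlockHom
  obtain ⟨U, hU, hU'⟩ := exists_relative_coordinates M.deck.subtype χ hA hAχ
  have hχ : ∀ k h, ∃ s : ℤˣ, ((s : ℤ) : ℂ) = χ k h := by
    intro k h
    have h1 : χ k h * χ k h = 1 := by rw [← map_mul, hsq, map_one]
    rcases mul_self_eq_one_iff.mp h1 with h2 | h2
    · exact ⟨1, by simp [h2]⟩
    · exact ⟨-1, by simp [h2]⟩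
  choose s hs using hχ
  let Θ : M.deck → Fin p → ℤˣ := fun h k => s k h
  have hΘ : ∀ h : M.deck, (h : FormalBihol (ZW p)) = U⁻¹ * flip (Θ h) * U := by
    intro h
    rw [mul_assoc, eq_inv_mul_iff_mul_eq]
    refine bihol_ext ?_
    rintro (i | k)
    · rw [comps_flip_mul_inl, comps_mul, hU, subst_X (hasSubst_comps _), h.2.1]
    · rw [comps_flip_mul_inr, comps_mul]
      refine (hU' k h).trans ?_
      rw [← hs k h]
      rfl
  have hinj : Function.Injective Θ := by
    intro g h hgh
    apply Subtype.ext
    rw [hΘ g, hΘ h, hgh]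
  -- The deck group and the group of sign changes both have $2^p$ elements, so injectivity suffices.
  have hbij : Function.Bijective Θ := by
    rw [Fintype.bijective_iff_injective_and_card]
    refine ⟨hinj, ?_⟩
    rw [← Nat.card_eq_fintype_card, hcard]
    simp
  refine ⟨U, hU, fun g => ⟨fun hg => ⟨Θ ⟨g, hg⟩, hΘ ⟨g, hg⟩⟩, ?_⟩⟩
  rintro ⟨t, rfl⟩
  obtain ⟨h, rfl⟩ := hbij.2 t
  rw [← hΘ h]
  exact h.2

end FormalSubmanifold

/-! ### Fixed-point ideals and the associated family -/

section Generalities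

variable {σ : Type} [Fintype σ]

/-- Divisibility by a variable becomes membership in the kernel of the ring homomorphism that sets
this variable to zero. As power series rings are reduced, the ideal of a variable is radical. -/
theorem X_dvd_iff_rescale [DecidableEq σ] (k : σ) (f : MvPowerSeries σ ℂ) :
    X k ∣ f ↔ rescale (Function.update (1 : σ → ℂ) k 0) f = 0 := by
  rw [X_dvd_iff, MvPowerSeries.ext_iff]
  refine forall_congr' fun m => ?_
  rw [coeff_rescale, Finsupp.prod_fintype _ _ (by simp), coeff_zero]
  constructor
  · intro h
    by_cases hm : m k = 0
    · rw [h hm, mul_zero]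
    · rw [Finset.prod_eq_zero (Finset.mem_univ k), zero_mul]
      simp [hm]
  · intro h hm
    rw [Finset.prod_eq_one, one_mul] at h
    · exact h
    · intro i _
      by_cases hi : i = k
      · rw [hi, hm, pow_zero]
      · simp [hi]

theorem X_dvd_of_dvd_pow (k : σ) {f : MvPowerSeries σ ℂ} {n : ℕ} (h : X k ∣ f ^ n) :
    X k ∣ f := by
  classical
  rw [X_dvd_iff_rescale, map_pow] at h
  rw [X_dvd_iff_rescale]
  exact eq_zero_of_pow_eq_zero h

theorem differential_apply (r : MvPowerSeries σ ℂ) (v : σ → ℂ) :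
    differential r v = linCoeff r ⬝ᵥ v := by
  simp [differential, dotProduct, linCoeff]

theorem differential_ne_zero_iff [DecidableEq σ] (r : MvPowerSeries σ ℂ) :
    differential r ≠ 0 ↔ linCoeff r ≠ 0 := by
  rw [not_iff_not]
  constructor
  · intro h
    ext k
    have := LinearMap.congr_fun h (Pi.single k 1)
    rwa [differential_apply, dotProduct_single_one] at this
  · intro h
    refine LinearMap.ext fun v => ?_
    rw [differential_apply, h, zero_dotProduct, LinearMap.zero_apply]

omit [Fintype σ] in
-- This is the product rule at a zero of `r`. If all components of $F-\mathrm{id}$ are multiples of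
-- `r`, it forces $LF-1$ to have rank at most one.
theorem linCoeff_mul {r : MvPowerSeries σ ℂ} (hr : constantCoeff r = 0) (c : MvPowerSeries σ ℂ) :
    linCoeff (r * c) = constantCoeff c • linCoeff r := by
  classical
  ext k
  rw [linCoeff, coeff_mul, Finsupp.antidiagonal_single, Finset.sum_map,
    Finset.Nat.sum_antidiagonal_eq_sum_range_succ_mk]
  simp [Finset.sum_range_succ, hr, linCoeff, mul_comm]

omit [Fintype σ] in
theorem linCoeff_sub (f g : MvPowerSeries σ ℂ) : linCoeff (f - g) = linCoeff f - linCoeff g := by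
  ext k
  simp [linCoeff]

omit [Fintype σ] in
theorem linCoeff_X [DecidableEq σ] (i : σ) : linCoeff (X i : MvPowerSeries σ ℂ) = Pi.single i 1 := by
  ext k
  simp [linCoeff, coeff_X, Finsupp.single_left_inj one_ne_zero, Pi.single_apply]

theorem linearPart_row_ne_zero [DecidableEq σ] (F : FormalBihol σ) (i : σ) :
    linearPart F i ≠ 0 :=
  (Matrix.linearIndependent_rows_iff_isUnit.mpr (isUnit_linearPart F)).ne_zero i

theorem fixIdeal_one : fixIdeal (1 : FormalBihol σ) = ⊥ := by
  have : (Set.range fun i => comps (1 : FormalBihol σ) i - X i) ⊆ {0} := by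
    rintro _ ⟨i, rfl⟩
    exact sub_self _
  rw [fixIdeal, eq_bot_iff, (Ideal.span_eq_bot.mpr fun x hx => this hx)]
  intro f hf
  obtain ⟨n, hn⟩ := hf
  exact eq_zero_of_pow_eq_zero hn

theorem not_isFormalHypersurface_bot [DecidableEq σ] :
    ¬ IsFormalHypersurface (⊥ : Ideal (MvPowerSeries σ ℂ)) := by
  rintro ⟨r, hr, -, h⟩
  have : r = 0 := by
    rw [← Ideal.mem_bot, hr]
    exact Ideal.mem_span_singleton_self r
  rw [differential_ne_zero_iff] at h
  apply h
  ext k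
  simp [this, linCoeff]

end Generalities

section Family

variable {p : ℕ}

theorem comps_flip (s : Fin p → ℤˣ) : comps (flip s) = (Sum.elim 1 (sgn s) : ZW p → ℂ) • X := by
  ext1 i
  rcases i with i | k
  · rw [comps_flip_inl, Pi.smul_apply', Sum.elim_inl, Pi.one_apply, one_smul]
  · rfl

theorem coeff_subst_flip (s : Fin p → ℤˣ) (f : MvPowerSeries (ZW p) ℂ) (m : ZW p →₀ ℕ) :
    coeff m (subst (comps (flip s)) f) = (∏ k, sgn s k ^ m (Sum.inr k)) * coeff m f := by
  rw [comps_flip, ← rescale_eq_subst, coeff_rescale, Finsupp.prod_fintype _ _ (by simp),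
    Fintype.prod_sum_type]
  simp

/-- The sign change in the `j`-th coordinate. -/
def signAt (j : Fin p) : Fin p → ℤˣ := Pi.mulSingle j (-1)

theorem sgn_signAt_self (j : Fin p) : sgn (signAt j) j = -1 := by
  simp [sgn, signAt]

theorem sgn_signAt_of_ne {j k : Fin p} (h : k ≠ j) : sgn (signAt j) k = 1 := by
  simp [sgn, signAt, h]

/-- The sign changes in the coordinates `U`. -/
def conjFlip (U : FormalBihol (ZW p)) : (Fin p → ℤˣ) →* FormalBihol (ZW p) :=
  (MulAut.conj U⁻¹).toMonoidHom.comp flip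

theorem conjFlip_apply (U : FormalBihol (ZW p)) (s : Fin p → ℤˣ) :
    conjFlip U s = U⁻¹ * flip s * U := by
  simp [conjFlip]

theorem conjFlip_injective (U : FormalBihol (ZW p)) : Function.Injective (conjFlip U) :=
  (MulAut.conj U⁻¹).injective.comp flip_injective

/-- The sign changes in the single coordinates of `U`. -/
def reflections (U : FormalBihol (ZW p)) (j : Fin p) : FormalBihol (ZW p) :=
  conjFlip U (signAt j)

theorem signAt_injective : Function.Injective (signAt : Fin p → Fin p → ℤˣ) := by
  intro j k h
  by_contra hne
  have h1 := sgn_signAt_self j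
  rw [h, sgn_signAt_of_ne hne] at h1
  norm_num at h1

theorem reflections_injective (U : FormalBihol (ZW p)) : Function.Injective (reflections U) :=
  (conjFlip_injective U).comp signAt_injective

theorem closure_range_reflections (U : FormalBihol (ZW p)) :
    Subgroup.closure (Set.range (reflections U)) = (conjFlip U).range := by
  apply le_antisymm
  · rw [Subgroup.closure_le]
    rintro _ ⟨j, rfl⟩
    exact ⟨signAt j, rfl⟩
  · rintro _ ⟨s, rfl⟩
    change s ∈ (Subgroup.closure (Set.range (reflections U))).comap (conjFlip U)
    rw [← Finset.univ_prod_mulSingle s]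
    refine Subgroup.prod_mem _ fun j _ => ?_
    rcases Int.units_eq_one_or (s j) with h | h
    · rw [h, Pi.mulSingle_one]
      exact one_mem _
    · rw [h]
      exact Subgroup.subset_closure ⟨j, rfl⟩

theorem comps_reflections_sub (U : FormalBihol (ZW p)) (s : Fin p → ℤˣ) (i : ZW p) :
    comps (conjFlip U s) i - X i =
      subst (comps U) (subst (comps (flip s)) (comps U⁻¹ i) - comps U⁻¹ i) := by
  rw [subst_sub (hasSubst_comps U), ← subst_comps_mul, ← comps_mul, ← comps_mul, conjFlip_apply,
    inv_mul_cancel, comps_one, mul_assoc]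

theorem subst_comps_inv_cancel (U : FormalBihol (ZW p)) (f : MvPowerSeries (ZW p) ℂ) :
    subst (comps U) (subst (comps U⁻¹) f) = f := by
  rw [← subst_comps_mul, inv_mul_cancel, subst_comps_one]

theorem subst_comps_cancel_inv (U : FormalBihol (ZW p)) (f : MvPowerSeries (ZW p) ℂ) :
    subst (comps U⁻¹) (subst (comps U) f) = f := by
  rw [← subst_comps_mul, mul_inv_cancel, subst_comps_one]

theorem comps_dvd_iff (U : FormalBihol (ZW p)) (k : ZW p) (f : MvPowerSeries (ZW p) ℂ) :
    comps U k ∣ f ↔ X k ∣ subst (comps U⁻¹) f := by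
  constructor
  · rintro ⟨g, rfl⟩
    refine ⟨subst (comps U⁻¹) g, ?_⟩
    rw [subst_mul (hasSubst_comps _), ← comps_mul, mul_inv_cancel, comps_one]
  · rintro ⟨g, hg⟩
    refine ⟨subst (comps U) g, ?_⟩
    rw [← subst_comps_inv_cancel U f, hg, subst_mul (hasSubst_comps _), subst_X (hasSubst_comps _)]

theorem X_dvd_subst_flip_signAt_sub (k : Fin p) (f : MvPowerSeries (ZW p) ℂ) :
    X (Sum.inr k) ∣ subst (comps (flip (signAt k))) f - f := by
  rw [X_dvd_iff]
  intro m hm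
  rw [map_sub, coeff_subst_flip, Finset.prod_eq_one, one_mul, sub_self]
  intro l _
  by_cases h : l = k
  · rw [h, hm, pow_zero]
  · rw [sgn_signAt_of_ne h, one_pow]

/-- In the coordinates `U` the components of the reflection minus the identity are divisible by
$w_k$, and $(w_k)$ is radical. Conversely, one of these components equals $w_k$ times a unit. -/
theorem fixIdeal_reflections (U : FormalBihol (ZW p)) (k : Fin p) :
    fixIdeal (reflections U k) = Ideal.span {comps U (Sum.inr k)} := by
  have hle : Ideal.span (Set.range fun i => comps (reflections U k) i - X i) ≤
      Ideal.span {comps U (Sum.inr k)} := by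
    rw [Ideal.span_le]
    rintro _ ⟨i, rfl⟩
    rw [SetLike.mem_coe, Ideal.mem_span_singleton]
    simp only [reflections]
    rw [comps_reflections_sub, comps_dvd_iff, subst_comps_cancel_inv]
    exact X_dvd_subst_flip_signAt_sub k _
  apply le_antisymm
  · rintro f ⟨n, hn⟩
    have := hle hn
    rw [Ideal.mem_span_singleton, comps_dvd_iff, subst_pow (hasSubst_comps _)] at this
    rw [Ideal.mem_span_singleton, comps_dvd_iff]
    exact X_dvd_of_dvd_pow _ this
  · rw [Ideal.span_singleton_le_iff_mem]
    apply Ideal.le_radical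
    obtain ⟨i, hi⟩ : ∃ i, linearPart U⁻¹ i (Sum.inr k) ≠ 0 := by
      by_contra! hcon
      have := (Matrix.linearIndependent_cols_iff_isUnit.mpr (isUnit_linearPart U⁻¹)).ne_zero
        (Sum.inr k)
      exact this (funext hcon)
    obtain ⟨h, hh⟩ := X_dvd_subst_flip_signAt_sub k (comps U⁻¹ i)
    -- The flip turns the linear coefficient of $w_k$ into its negative, so the difference has
    -- linear coefficient $-2$ times it; this was chosen nonzero, so `h` is a unit.
    have hc : constantCoeff h = -2 * linearPart U⁻¹ i (Sum.inr k) := by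
      have h1 := congrFun (congrArg linCoeff hh) (Sum.inr k)
      rw [linCoeff_mul (constantCoeff_X _), linCoeff_X, linCoeff_sub, linCoeff_subst,
        linearPart_flip, Pi.sub_apply, Matrix.vecMul_diagonal, Pi.smul_apply, Pi.single_eq_same,
        Sum.elim_inr, sgn_signAt_self, linCoeff_comps, smul_eq_mul, mul_one] at h1
      rw [← h1]
      ring
    have hu : IsUnit h := by
      rw [isUnit_iff_constantCoeff, hc, isUnit_iff_ne_zero]
      simpa using hi
    obtain ⟨h', hh'⟩ := hu.exists_right_inv
    have : comps U (Sum.inr k) = subst (comps U) h' * (comps (reflections U k) i - X i) := by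
      rw [reflections, comps_reflections_sub, hh, ← subst_mul (hasSubst_comps _), mul_comm h',
        mul_assoc, hh', mul_one, subst_X (hasSubst_comps _)]
    rw [this]
    exact Ideal.mul_mem_left _ _ (Ideal.subset_span ⟨i, rfl⟩)

theorem isFormalHypersurface_reflections (U : FormalBihol (ZW p)) (k : Fin p) :
    IsFormalHypersurface (fixIdeal (reflections U k)) :=
  ⟨comps U (Sum.inr k), fixIdeal_reflections U k, constantCoeff_comps _ _,
    (differential_ne_zero_iff _).mpr (linearPart_row_ne_zero U _)⟩

/-- A principal fixed-point ideal forces the linear part minus the identity to have rank at most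
one, while for a sign change this rank is the number of changed signs. The identity is excluded
because its fixed-point ideal is zero. -/
theorem exists_eq_signAt_of_isFormalHypersurface (U : FormalBihol (ZW p)) {s : Fin p → ℤˣ}
    (h : IsFormalHypersurface (fixIdeal (conjFlip U s))) : ∃ k, s = signAt k := by
  have hs : s ≠ 1 := by
    rintro rfl
    rw [map_one, fixIdeal_one] at h
    exact not_isFormalHypersurface_bot h
  obtain ⟨r, hr, hr0, -⟩ := h
  have hmem : ∀ i, ∃ c, comps (conjFlip U s) i - X i = r * c := by
    intro i
    have : comps (conjFlip U s) i - X i ∈ fixIdeal (conjFlip U s) :=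
      Ideal.le_radical (Ideal.subset_span ⟨i, rfl⟩)
    rwa [hr, Ideal.mem_span_singleton] at this
  choose c hc using hmem
  have hrank : linearPart (conjFlip U s) - 1 =
      Matrix.vecMulVec (fun i => constantCoeff (c i)) (linCoeff r) := by
    ext i k
    have := congrArg linCoeff (hc i)
    rw [linCoeff_sub, linCoeff_mul hr0, linCoeff_X, linCoeff_comps] at this
    have := congrFun this k
    rw [Matrix.vecMulVec_apply, Matrix.sub_apply, Matrix.one_apply]
    simpa [Pi.single_apply, eq_comm] using this
  have hconj : linearPart (flip s) - 1 =
      linearPart U * (linearPart (conjFlip U s) - 1) * linearPart U⁻¹ := by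
    rw [mul_sub, sub_mul, ← linearPart_mul, ← linearPart_mul, mul_one, ← linearPart_mul,
      mul_inv_cancel, linearPart_one, conjFlip_apply]
    congr 2
    group
  rw [hrank, Matrix.mul_vecMulVec, Matrix.vecMulVec_mul] at hconj
  set a := Matrix.mulVec (linearPart U) fun i => constantCoeff (c i)
  set b := Matrix.vecMul (linCoeff r) (linearPart U⁻¹)
  have hentry : ∀ k l, (if k = l then sgn s k - 1 else 0) = a (Sum.inr k) * b (Sum.inr l) := by
    intro k l
    have := congrFun (congrFun hconj (Sum.inr k)) (Sum.inr l)
    rw [Matrix.vecMulVec_apply, linearPart_flip, Matrix.sub_apply, Matrix.diagonal_apply,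
      Matrix.one_apply] at this
    rw [← this]
    by_cases hkl : k = l <;> simp [hkl]
  obtain ⟨k, hk⟩ : ∃ k, s k ≠ 1 := by
    by_contra! hcon
    exact hs (funext hcon)
  have hneg : ∀ l, s l ≠ 1 → s l = -1 := fun l hl => (Int.units_eq_one_or _).resolve_left hl
  have hval : ∀ l, s l ≠ 1 → a (Sum.inr l) * b (Sum.inr l) ≠ 0 := by
    intro l hl
    rw [← hentry, if_pos rfl, sgn, hneg l hl]
    norm_num
  refine ⟨k, funext fun l => ?_⟩
  by_cases hlk : l = k
  · rw [hlk, hneg k hk, signAt, Pi.mulSingle_eq_same]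
  · rw [signAt, Pi.mulSingle_eq_of_ne hlk]
    by_contra hl
    have h0 := hentry k l
    rw [if_neg (Ne.symm hlk)] at h0
    exact mul_ne_zero (left_ne_zero_of_mul (hval k hk)) (right_ne_zero_of_mul (hval l hl)) h0.symm

namespace FormalSubmanifold

variable {M : FormalSubmanifold p} {U : FormalBihol (ZW p)}

theorem isAssociatedFamily_reflections (hU : M.deck = (conjFlip U).range) :
    M.IsAssociatedFamily (reflections U) :=
  ⟨reflections_injective U, by rw [closure_range_reflections, hU],
    isFormalHypersurface_reflections U⟩

/-- Every member is a reflection of `U` by the rank argument, and `p` distinct members exhaust the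
`p` reflections. -/
theorem IsAssociatedFamily.range_eq (hU : M.deck = (conjFlip U).range)
    {τ : Fin p → FormalBihol (ZW p)} (hτ : M.IsAssociatedFamily τ) :
    Set.range τ = Set.range (reflections U) := by
  obtain ⟨hinj, hcl, hfix⟩ := hτ
  have hex : ∀ j, ∃ k, τ j = reflections U k := by
    intro j
    have hj : τ j ∈ M.deck := by
      rw [← hcl]
      exact Subgroup.subset_closure ⟨j, rfl⟩
    rw [hU] at hj
    obtain ⟨s, hs⟩ := hj
    have hj := hfix j
    rw [← hs] at hj
    obtain ⟨k, rfl⟩ := exists_eq_signAt_of_isFormalHypersurface U hj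
    exact ⟨k, hs.symm⟩
  choose e he using hex
  have hein : Function.Injective e := fun i j hij => hinj (by rw [he, he, hij])
  have hesurj : Function.Surjective e := Finite.surjective_of_injective hein
  rw [show τ = reflections U ∘ e from funext he, hesurj.range_comp]

theorem exists_deck_eq_range (hM : M.ConditionD) :
    ∃ U : FormalBihol (ZW p), (∀ i, comps U (Sum.inl i) = X (Sum.inl i)) ∧
      M.deck = (conjFlip U).range := by
  obtain ⟨U, hU, h⟩ := M.exists_normalizing_coordinates hM
  refine ⟨U, hU, Subgroup.ext fun g => ?_⟩
  rw [h, MonoidHom.mem_range]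
  simp only [conjFlip_apply, eq_comm]

/-- The associated family of involutions exists and is unique up to order. -/
theorem existsUnique_associatedFamily (hM : M.ConditionD) :
    ∃ τ : Fin p → FormalBihol (ZW p), M.IsAssociatedFamily τ ∧
      ∀ τ' : Fin p → FormalBihol (ZW p), M.IsAssociatedFamily τ' →
        Set.range τ' = Set.range τ := by
  obtain ⟨U, -, hU⟩ := exists_deck_eq_range hM
  exact ⟨reflections U, isAssociatedFamily_reflections hU, fun τ' hτ' => hτ'.range_eq hU⟩

end FormalSubmanifold

end Family

/-! ### Invariants of the sign changes -/

section Squares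

variable {p : ℕ}

/-- The map `(z', w') ↦ (z', w'₁², …, w'ₚ²)`. -/
def squareMap (p : ℕ) : FormalMap (ZW p) where
  toFun := Sum.elim (fun i => X (Sum.inl i)) fun k => X (Sum.inr k) ^ 2
  map_zero := by rintro (i | k) <;> simp

/-- Doubling of the exponents of the `w`-coordinates. -/
def dbl (d : ZW p →₀ ℕ) : ZW p →₀ ℕ :=
  Finsupp.equivFunOnFinite.symm fun i => (Sum.elim 1 2 : ZW p → ℕ) i * d i

theorem dbl_apply (d : ZW p →₀ ℕ) (i : ZW p) : dbl d i = (Sum.elim 1 2 : ZW p → ℕ) i * d i := rfl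

theorem dbl_injective : Function.Injective (dbl : (ZW p →₀ ℕ) → ZW p →₀ ℕ) := by
  intro d e h
  ext i
  have := DFunLike.congr_fun h i
  rw [dbl_apply, dbl_apply] at this
  rcases i with i | k
  · simpa using this
  · simpa using this

theorem prod_squareMap (d : ZW p →₀ ℕ) :
    (d.prod fun i n => (squareMap p).toFun i ^ n) = monomial (dbl d) 1 := by
  rw [monomial_one_eq, Finsupp.prod_fintype _ _ (by simp), Finsupp.prod_fintype _ _ (by simp)]
  refine Finset.prod_congr rfl fun i _ => ?_
  rw [dbl_apply, pow_mul]
  rcases i with i | k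
  · simp [squareMap]
  · simp [squareMap]

theorem coeff_dbl_subst_squareMap (g : MvPowerSeries (ZW p) ℂ) (d : ZW p →₀ ℕ) :
    coeff (dbl d) (subst (squareMap p).toFun g) = coeff d g := by
  classical
  rw [coeff_subst (squareMap p).hasSubst, finsum_eq_single _ d]
  · rw [prod_squareMap, coeff_monomial_same, smul_eq_mul, mul_one]
  · intro e he
    rw [prod_squareMap, coeff_monomial_ne (fun h => he (dbl_injective h).symm), smul_zero]

theorem coeff_subst_squareMap_of_notMem (g : MvPowerSeries (ZW p) ℂ) {m : ZW p →₀ ℕ}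
    (hm : m ∉ Set.range dbl) : coeff m (subst (squareMap p).toFun g) = 0 := by
  classical
  rw [coeff_subst (squareMap p).hasSubst, finsum_eq_zero_of_forall_eq_zero]
  intro e
  rw [prod_squareMap, coeff_monomial_ne (fun h => hm ⟨e, h.symm⟩), smul_zero]

/-- Doubling the $w'$-exponents is injective, so no coefficient is lost under the substitution. -/
theorem mul_squareMap_cancel {F G : FormalMap (ZW p)} (h : F * squareMap p = G * squareMap p) :
    F = G := by
  refine FormalMap.ext_apply fun i => ?_
  ext d
  rw [← coeff_dbl_subst_squareMap (F.toFun i), ← coeff_dbl_subst_squareMap (G.toFun i)]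
  exact congrArg (coeff (dbl d)) (congrFun (congrArg FormalMap.toFun h) i)

/-- A power series that is even in each `w`-coordinate is a power series in `z'` and in the squares
of the `w`-coordinates. -/
theorem exists_eq_subst_squareMap {f : MvPowerSeries (ZW p) ℂ}
    (hf : ∀ s, subst (comps (flip s)) f = f) : ∃ g : MvPowerSeries (ZW p) ℂ, f = subst (squareMap p).toFun g := by
  let g : MvPowerSeries (ZW p) ℂ := fun d => coeff (dbl d) f
  have hg : ∀ d, coeff d g = coeff (dbl d) f := fun _ => rfl
  refine ⟨g, ?_⟩
  ext m
  by_cases hm : m ∈ Set.range dbl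
  · obtain ⟨d, rfl⟩ := hm
    rw [coeff_dbl_subst_squareMap, hg]
  · rw [coeff_subst_squareMap_of_notMem _ hm]
    obtain ⟨k, hk⟩ : ∃ k, ¬ Even (m (Sum.inr k)) := by
      by_contra! hcon
      refine hm ⟨Finsupp.equivFunOnFinite.symm
        (Sum.elim (fun i => m (Sum.inl i)) fun k => m (Sum.inr k) / 2), ?_⟩
      ext i
      rw [dbl_apply]
      rcases i with i | k
      · simp
      · simp [Nat.two_mul_div_two_of_even (hcon k)]
    -- If the exponent of $w_k$ is odd, flipping $w_k$ negates the coefficient, which must therefore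
    -- vanish.
    have h := congrArg (coeff m) (hf (signAt k))
    rw [coeff_subst_flip, Finset.prod_eq_single k, sgn_signAt_self,
      (Nat.not_even_iff_odd.mp hk).neg_one_pow] at h
    · linear_combination -(1 / 2 : ℂ) * h
    · intro l _ hl
      rw [sgn_signAt_of_ne hl, one_pow]
    · simp

theorem exists_eq_mul_squareMap {F : FormalMap (ZW p)}
    (hF : ∀ s, F * (flip s : FormalBihol (ZW p)) = F) : ∃ G, F = G * squareMap p := by
  have h : ∀ i, ∃ g : MvPowerSeries (ZW p) ℂ, F.toFun i = subst (squareMap p).toFun g := fun i =>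
    exists_eq_subst_squareMap fun s => congrFun (congrArg FormalMap.toFun (hF s)) i
  choose g hg using h
  refine ⟨⟨g, fun i => ?_⟩, FormalMap.ext_apply hg⟩
  rw [← constantCoeff_subst_of_zero (squareMap p).map_zero, ← hg, F.map_zero]

theorem squareMap_mul_flip (s : Fin p → ℤˣ) :
    squareMap p * (flip s : FormalBihol (ZW p)) = squareMap p := by
  refine FormalMap.ext_apply ?_
  rintro (i | k)
  · exact subst_X (R := ℂ) (hasSubst_comps (flip s)) _
  · change subst (comps (flip s)) (X (Sum.inr k) ^ 2 : MvPowerSeries (ZW p) ℂ) = X (Sum.inr k) ^ 2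
    rw [subst_pow (hasSubst_comps _), subst_X (hasSubst_comps _), comps_flip_inr, smul_pow]
    rcases sgn_eq_one_or s k with h | h <;> simp [h]

end Squares

theorem coeff_two_sq {f : MvPowerSeries Unit ℂ} (hf : constantCoeff f = 0) :
    coeff (Finsupp.single () 2) (f ^ 2) = coeff (Finsupp.single () 1) f ^ 2 := by
  classical
  rw [pow_two, coeff_mul, Finsupp.antidiagonal_single, Finset.sum_map,
    show Finset.HasAntidiagonal.antidiagonal 2 = ({(0, 2), (1, 1), (2, 0)} : Finset (ℕ × ℕ)) from rfl,
    Finset.sum_insert (by decide), Finset.sum_insert (by decide), Finset.sum_singleton]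
  simp only [Function.Embedding.prodMap, Function.Embedding.coeFn_mk, Prod.map,
    Finsupp.single_zero, coeff_zero_eq_constantCoeff_apply, hf]
  ring

/-! ### The branched cover $(z',E)$ -/

namespace FormalSubmanifold

variable {p : ℕ}

/-- The map `(z', w') ↦ (z', E(z', w'))`. -/
def param (M : FormalSubmanifold p) : FormalMap (ZW p) where
  toFun := Sum.elim (fun i => X (Sum.inl i)) M.E
  map_zero := by
    rintro (i | j)
    · exact constantCoeff_X _
    · rw [Sum.elim_inr, ← one_le_order_iff_constCoeff_eq_zero]
      exact le_trans (by norm_num) (M.two_le_order j)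

theorem mem_deck_iff (M : FormalSubmanifold p) (τ : FormalBihol (ZW p)) :
    τ ∈ M.deck ↔ M.param * (τ : FormalMap (ZW p)) = M.param := by
  constructor
  · rintro ⟨h1, h2⟩
    refine FormalMap.ext_apply ?_
    rintro (i | j)
    · exact (subst_X (R := ℂ) (hasSubst_comps τ) _).trans (h1 i)
    · exact h2 j
  · intro h
    refine ⟨fun i => ?_, fun j => congrFun (congrArg FormalMap.toFun h) (Sum.inr j)⟩
    exact (subst_X (R := ℂ) (hasSubst_comps τ) _).symm.trans
      (congrFun (congrArg FormalMap.toFun h) (Sum.inl i))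

/-- The map `(z', E)` is, up to changes of coordinates, the map `(z', w') ↦ (z', w'²)`. -/
theorem exists_param_eq (M : FormalSubmanifold p) (hM : M.ConditionB) {U : FormalBihol (ZW p)}
    (hU : ∀ i, comps U (Sum.inl i) = X (Sum.inl i)) (hdeck : M.deck = (conjFlip U).range) :
    ∃ e : FormalBihol (ZW p), M.param = e * squareMap p * U := by
  obtain ⟨e, he⟩ := exists_eq_mul_squareMap (F := M.param * ((U⁻¹ : FormalBihol (ZW p)) : FormalMap (ZW p))) (by
    intro s
    have h : conjFlip U s ∈ M.deck := hdeck ▸ ⟨s, rfl⟩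
    rw [mem_deck_iff, conjFlip_apply, Units.val_mul, Units.val_mul, ← mul_assoc, ← mul_assoc] at h
    rw [Units.eq_mul_inv_iff_mul_eq, h])
  have hP : M.param = e * squareMap p * U := by
    rw [← he, mul_assoc, ← Units.val_mul, inv_mul_cancel, Units.val_one, mul_one]
  have heinl : ∀ i, e.toFun (Sum.inl i) = X (Sum.inl i) := by
    intro i
    have h1 := congrFun (congrArg FormalMap.toFun he) (Sum.inl i)
    have h2 : (M.param * ((U⁻¹ : FormalBihol (ZW p)) : FormalMap (ZW p))).toFun (Sum.inl i) = X (Sum.inl i) := by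
      change subst (comps U⁻¹) (X (Sum.inl i) : MvPowerSeries (ZW p) ℂ) = _
      have h3 := subst_comps_cancel_inv U (X (Sum.inl i))
      rwa [subst_X (hasSubst_comps U), hU] at h3
    rw [h2, FormalMap.mul_toFun] at h1
    ext d
    rw [← coeff_dbl_subst_squareMap (e.toFun _), ← h1,
      ← coeff_dbl_subst_squareMap (X (Sum.inl i)) d, subst_X (squareMap p).hasSubst]
    rfl
  set c := e.jac.toBlocks₂₂
  have hinl : ∀ i k, e.jac (Sum.inl i) k = (1 : Matrix (ZW p) (ZW p) ℂ) (Sum.inl i) k := by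
    intro i k
    rw [← FormalMap.jac_one, FormalMap.jac_apply, heinl]
    rfl
  have hjac : e.jac = Matrix.fromBlocks 1 0 e.jac.toBlocks₂₁ c := by
    conv_lhs => rw [← Matrix.fromBlocks_toBlocks e.jac]
    congr 1
    · ext i j
      rw [Matrix.toBlocks₁₁, Matrix.of_apply, hinl, Matrix.one_apply, Matrix.one_apply]
      simp
    · ext i j
      rw [Matrix.toBlocks₁₂, Matrix.of_apply, hinl, Matrix.one_apply]
      simp
  have hc : IsUnit c := by
    -- For `s` in the kernel of `c`, choose `y` with $y_k^2=s_k$ and `w` mapped to `y` by the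
    -- $w'$-block of `U`. Then $q(w)=c\,s=0$, so condition B gives $w=0$ and hence $s=0$.
    refine Matrix.mulVec_injective_iff_isUnit.mp
      ((injective_iff_map_eq_zero (Matrix.mulVecLin c)).mpr ?_)
    intro s hs
    choose y hy using fun k => IsAlgClosed.exists_pow_nat_eq (s k) two_pos
    obtain ⟨w, hw⟩ := Matrix.mulVec_surjective_iff_isUnit.mpr (isUnit_wBlock hU) y
    have hw0 : w = 0 := by
      apply hM
      intro j
      rw [← M.coeff_subst_E j (constantCoeff_line w) (coeff_line_inl w) (coeff_line_inr w)]
      have hE : M.E j = subst (comps U) (subst (squareMap p).toFun (e.toFun (Sum.inr j))) :=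
        congrFun (congrArg FormalMap.toFun hP) (Sum.inr j)
      have hbs := hasSubst_of_constantCoeff_zero (a := fun i => subst (line w)
        ((squareMap p * (U : FormalMap (ZW p))).toFun i)) fun i => by
          rw [constantCoeff_subst_of_zero (constantCoeff_line w), FormalMap.map_zero]
      rw [hE]
      change coeff _ (subst (line w) (subst (U : FormalMap (ZW p)).toFun _)) = 0
      rw [← FormalMap.subst_mul_toFun, subst_comp_subst_apply (FormalMap.hasSubst _)
        (hasSubst_line w)]
      set b : ZW p → MvPowerSeries Unit ℂ := fun i => subst (line w)
        ((squareMap p * (U : FormalMap (ZW p))).toFun i) with hbdef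
      have hbl : ∀ i, b (Sum.inl i) = 0 := by
        intro i
        change subst (line w) (subst (comps U) (X (Sum.inl i) : MvPowerSeries (ZW p) ℂ)) = 0
        rw [subst_X (hasSubst_comps U), hU, subst_X (hasSubst_line w)]
        rfl
      have hbr : ∀ k, b (Sum.inr k) = subst (line w) (comps U (Sum.inr k)) ^ 2 := by
        intro k
        change subst (line w) (subst (comps U) (X (Sum.inr k) ^ 2 : MvPowerSeries (ZW p) ℂ)) = _
        rw [subst_pow (hasSubst_comps U), subst_X (hasSubst_comps U), subst_pow (hasSubst_line w)]
      have hb2 : ∀ i, (2 : ℕ∞) ≤ (b i).order := by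
        rintro (i | k)
        · rw [hbl, order_zero]
          exact le_top
        · rw [hbr]
          exact le_order_pow_of_constantCoeff_eq_zero 2
            (by rw [constantCoeff_subst_of_zero (constantCoeff_line w), constantCoeff_comps])
      set ℓ := linForm (linCoeff (e.toFun (Sum.inr j))) with hℓ
      have hrest : ((2 : ℕ) : ℕ∞) ≤ (e.toFun (Sum.inr j) - ℓ).order := by
        rw [natCast_le_order_iff]
        intro d hd
        rcases Nat.lt_or_ge d.degree 1 with h | h
        · have : d = 0 := by
            rw [← Finsupp.degree_eq_zero_iff]; omega
          subst this
          rw [coeff_zero_eq_constantCoeff_apply, map_sub, FormalMap.map_zero,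
            constantCoeff_linForm, sub_zero]
        · obtain ⟨k, rfl⟩ := exists_eq_single_of_degree_eq_one (d := d) (by omega)
          have := congrFun (linCoeff_linForm (linCoeff (e.toFun (Sum.inr j)))) k
          rw [map_sub, sub_eq_zero]
          exact this.symm
      -- The curve `b` has order at least two, so the nonlinear terms of `e` contribute only from
      -- order four on.
      have hrest2 : coeff (Finsupp.single () 2) (subst b (e.toFun (Sum.inr j) - ℓ)) = 0 := by
        apply coeff_of_lt_order
        refine lt_of_lt_of_le ?_ (le_order_subst hbs _)
        refine lt_of_lt_of_le ?_ (mul_le_mul' (le_iInf hb2) hrest)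
        rw [Finsupp.degree_single]
        norm_num
      rw [subst_sub hbs, map_sub, sub_eq_zero] at hrest2
      rw [hrest2, hℓ, linForm, subst_sum hbs, map_sum, Fintype.sum_sum_type, Finset.sum_eq_zero,
        zero_add]
      · refine Eq.trans (Finset.sum_congr rfl fun k _ => ?_) (congrFun hs j)
        rw [subst_smul hbs, subst_X hbs, hbr, coeff_smul, coeff_two_sq
          (by rw [constantCoeff_subst_of_zero (constantCoeff_line w), constantCoeff_comps]),
          coeff_subst_line_comps_inr, hw, hy]
        rfl
      · intro i _
        rw [subst_smul hbs, subst_X hbs, hbl, smul_zero, map_zero]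
    ext k
    rw [← hy k, ← hw, hw0, Matrix.mulVec_zero]
    simp
  obtain ⟨e', he'⟩ := e.isUnit_of_isUnit_jac (by
    rw [hjac, Matrix.isUnit_fromBlocks_zero₁₂]
    exact ⟨isUnit_one, hc⟩)
  exact ⟨e', by rw [he', hP]⟩

/-- The normal form of $(z',E)$ reduces the cancellation to that of the squaring map, as the other
two factors are invertible. -/
theorem mul_param_cancel {M : FormalSubmanifold p} (hM : M.ConditionD) {F G : FormalMap (ZW p)}
    (h : F * M.param = G * M.param) : F = G := by
  obtain ⟨U, hU, hdeck⟩ := exists_deck_eq_range hM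
  obtain ⟨e, he⟩ := M.exists_param_eq hM.1 hU hdeck
  rw [he, ← mul_assoc, ← mul_assoc, ← mul_assoc, ← mul_assoc, Units.mul_left_inj] at h
  exact (Units.mul_left_inj e).mp (mul_squareMap_cancel h)

/-- Maps that are invariant under the deck transformations factor through `(z', E)`. -/
theorem exists_eq_mul_param {M : FormalSubmanifold p} (hM : M.ConditionD) {F : FormalMap (ZW p)}
    (hF : ∀ τ ∈ M.deck, F * (τ : FormalMap (ZW p)) = F) : ∃ f, F = f * M.param := by
  obtain ⟨U, hU, hdeck⟩ := exists_deck_eq_range hM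
  obtain ⟨e, he⟩ := M.exists_param_eq hM.1 hU hdeck
  obtain ⟨g, hg⟩ := exists_eq_mul_squareMap (F := F * ((U⁻¹ : FormalBihol (ZW p)) : FormalMap (ZW p))) (by
    intro s
    have h := hF (conjFlip U s) (hdeck ▸ ⟨s, rfl⟩)
    rw [conjFlip_apply, Units.val_mul, Units.val_mul, ← mul_assoc, ← mul_assoc] at h
    rw [Units.eq_mul_inv_iff_mul_eq, h])
  refine ⟨g * ((e⁻¹ : FormalBihol (ZW p)) : FormalMap (ZW p)), ?_⟩
  rw [he, mul_assoc e.1, mul_assoc g, Units.inv_mul_cancel_left, ← mul_assoc, ← hg,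
    mul_assoc, ← Units.val_mul, inv_mul_cancel, Units.val_one, mul_one]

end FormalSubmanifold

/-! ### Ideals generated by variables -/

section Vanishing

variable {σ : Type}

theorem mem_span_X_of_coeff_eq_zero (S : Finset σ) {f : MvPowerSeries σ ℂ}
    (hf : ∀ m : σ →₀ ℕ, (∀ a ∈ S, m a = 0) → coeff m f = 0) :
    f ∈ Ideal.span ((fun a => (X a : MvPowerSeries σ ℂ)) '' S) := by
  classical
  induction S using Finset.induction_on generalizing f with
  | empty =>
    have : f = 0 := by
      ext m
      rw [hf m (by simp), coeff_zero]
    rw [this]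
    exact zero_mem _
  | insert a S _ ih =>
    let g : MvPowerSeries σ ℂ := fun m => if m a = 0 then coeff m f else 0
    have hg : ∀ m, coeff m g = if m a = 0 then coeff m f else 0 := fun _ => rfl
    have h1 : g ∈ Ideal.span ((fun a => (X a : MvPowerSeries σ ℂ)) '' (insert a S : Finset σ)) := by
      refine Ideal.span_mono (Set.image_mono (by simp)) (ih fun m hm => ?_)
      rw [hg]
      split_ifs with h0
      · refine hf m fun b hb => ?_
        rcases Finset.mem_insert.mp hb with rfl | hb
        · exact h0
        · exact hm b hb
      · rfl
    have h2 : X a ∣ f - g := by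
      rw [X_dvd_iff]
      intro m hm
      rw [map_sub, hg, if_pos hm, sub_self]
    obtain ⟨c, hc⟩ := h2
    rw [← sub_add_cancel f g, hc]
    exact add_mem (Ideal.mul_mem_right _ _ (Ideal.subset_span ⟨a, by simp, rfl⟩)) h1

theorem subst_mem_span {τ : Type} {a : σ → MvPowerSeries τ ℂ} (ha : HasSubst a)
    {s : Set (MvPowerSeries σ ℂ)} {f : MvPowerSeries σ ℂ} (hf : f ∈ Ideal.span s) :
    subst a f ∈ Ideal.span ((fun g => subst a g) '' s) := by
  have h := Ideal.mem_map_of_mem (substAlgHom ha (R := ℂ)).toRingHom hf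
  have h' : ∀ g, (substAlgHom ha (R := ℂ)).toRingHom g = subst a g := substAlgHom_apply ha
  rw [Ideal.map_span, h'] at h
  refine Ideal.span_mono ?_ h
  rintro _ ⟨g, hg, rfl⟩
  exact ⟨g, hg, (h' g).symm⟩

end Vanishing

/-! ### Maps commuting with $\rho_0$ -/

section Reality

variable {p : ℕ}

/-- Formal maps that commute with `ρ₀`. -/
def IsReal (F : FormalMap (ZW p)) : Prop := F * swap p = swap p * FormalMap.bar F

theorem bar_bar (F : FormalMap (ZW p)) : FormalMap.bar (FormalMap.bar F) = F := by
  refine FormalMap.ext_apply fun i => ?_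
  ext d
  exact Complex.conj_conj _

theorem bar_swap : FormalMap.bar (swap p) = swap p := by
  refine FormalMap.ext_apply fun i => ?_
  exact MvPowerSeries.map_X _ i.swap

theorem swap_mul_toFun (F : FormalMap (ZW p)) (i : ZW p) :
    (swap p * F).toFun i = F.toFun i.swap := by
  change subst F.toFun (X i.swap : MvPowerSeries (ZW p) ℂ) = _
  rw [subst_X F.hasSubst]

theorem IsReal.bar_mul_swap {F : FormalMap (ZW p)} (hF : IsReal F) :
    FormalMap.bar F * swap p = swap p * F := by
  have := congrArg FormalMap.bar hF
  rwa [map_mul, map_mul, bar_bar, bar_swap] at this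

theorem IsReal.mul {F G : FormalMap (ZW p)} (hF : IsReal F) (hG : IsReal G) : IsReal (F * G) := by
  rw [IsReal, mul_assoc, hG, ← mul_assoc, hF, map_mul, mul_assoc]

theorem intertwines_rho0_iff (F : FormalBihol (ZW p)) :
    Intertwines F (rho0 p) (rho0 p) ↔ IsReal (F : FormalMap (ZW p)) := by
  rw [Intertwines, Units.ext_iff]
  rfl

/-- The real map with the same `z`-components as `F`. -/
def realify (F : FormalMap (ZW p)) : FormalMap (ZW p) where
  toFun := Sum.elim (fun i => F.toFun (Sum.inl i))
    fun i => (FormalMap.bar F * swap p).toFun (Sum.inl i)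
  map_zero := by
    rintro (i | i)
    · exact F.map_zero _
    · exact FormalMap.map_zero _ _

theorem isReal_of_toFun_inr {F : FormalMap (ZW p)}
    (h : ∀ i, F.toFun (Sum.inr i) = (FormalMap.bar F * swap p).toFun (Sum.inl i)) : IsReal F := by
  refine FormalMap.ext_apply ?_
  rintro (i | i)
  · rw [swap_mul_toFun]
    change _ = conj (F.toFun (Sum.inr i))
    rw [h]
    change _ = (FormalMap.bar (FormalMap.bar F * swap p)).toFun (Sum.inl i)
    rw [map_mul, bar_bar, bar_swap]
  · rw [swap_mul_toFun, FormalMap.mul_toFun, h, ← FormalMap.mul_toFun, mul_assoc, swap_mul_swap,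
      mul_one]
    rfl

theorem isReal_realify (F : FormalMap (ZW p)) : IsReal (realify F) :=
  isReal_of_toFun_inr fun _ => rfl

/-- Commuting with $\rho_0$ expresses the $w'$-components through the conjugates of the
$z'$-components. -/
theorem IsReal.ext {F G : FormalMap (ZW p)} (hF : IsReal F) (hG : IsReal G)
    (h : ∀ i, F.toFun (Sum.inl i) = G.toFun (Sum.inl i)) : F = G := by
  refine FormalMap.ext_apply ?_
  rintro (i | i)
  · exact h i
  · have h1 := congrFun (congrArg FormalMap.toFun hF.bar_mul_swap) (Sum.inl i)
    have h2 := congrFun (congrArg FormalMap.toFun hG.bar_mul_swap) (Sum.inl i)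
    rw [swap_mul_toFun] at h1 h2
    change F.toFun (Sum.inr i) = G.toFun (Sum.inr i)
    refine h1.symm.trans (Eq.trans ?_ h2)
    change subst _ (conj (F.toFun (Sum.inl i))) = subst _ (conj (G.toFun (Sum.inl i)))
    rw [h]

end Reality

/-! ### The ideal of a manifold and its parametrization -/

namespace FormalSubmanifold

variable {p : ℕ}

/-- The complexification `(z', w') ↦ (F(z', w'), \bar F(w', z'))`. -/
def pairing (F : FormalMap (ZW p)) : Ambient p → MvPowerSeries (ZW p) ℂ :=
  Sum.elim F.toFun (FormalMap.bar F * swap p).toFun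

theorem constantCoeff_pairing (F : FormalMap (ZW p)) (i : Ambient p) :
    constantCoeff (pairing F i) = 0 := by
  rcases i with i | i
  · exact F.map_zero i
  · exact FormalMap.map_zero _ i

theorem hasSubst_pairing (F : FormalMap (ZW p)) : HasSubst (pairing F) :=
  hasSubst_of_constantCoeff_zero (constantCoeff_pairing F)

theorem constantCoeff_complexify (f : FormalBihol (Fin p ⊕ Fin p)) (i : Ambient p) :
    constantCoeff (complexify f i) = 0 := by
  rcases i with i | i
  · exact (constantCoeff_subst_of_zero (fun _ => constantCoeff_X _) _).trans
      (constantCoeff_comps f i)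
  · exact (constantCoeff_subst_of_zero (fun _ => constantCoeff_X _) _).trans
      (FormalMap.map_zero (FormalMap.bar (f : FormalMap (ZW p))) i)

theorem hasSubst_complexify (f : FormalBihol (Fin p ⊕ Fin p)) : HasSubst (complexify f) :=
  hasSubst_of_constantCoeff_zero (constantCoeff_complexify f)

theorem hasSubst_X_comp {α β : Type} [Finite α] (g : α → β) :
    HasSubst (fun i => X (g i) : α → MvPowerSeries β ℂ) :=
  hasSubst_of_constantCoeff_zero fun _ => constantCoeff_X _

theorem subst_pairing_complexify (f : FormalBihol (Fin p ⊕ Fin p)) (F : FormalMap (ZW p))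
    (r : MvPowerSeries (Ambient p) ℂ) :
    subst (pairing F) (subst (complexify f) r) =
      subst (pairing ((f : FormalMap (ZW p)) * F)) r := by
  rw [subst_comp_subst_apply (hasSubst_complexify f) (hasSubst_pairing F)]
  congr 1
  ext1 i
  rcases i with i | i
  · refine (subst_comp_subst_apply (hasSubst_X_comp _) (hasSubst_pairing F) _).trans ?_
    simp only [subst_X (hasSubst_pairing F)]
    rfl
  · refine (subst_comp_subst_apply (hasSubst_X_comp _) (hasSubst_pairing F) _).trans ?_
    simp only [subst_X (hasSubst_pairing F)]
    change subst (FormalMap.bar F * swap p).toFun ((FormalMap.bar (f : FormalMap (ZW p))).toFun i) =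
      (FormalMap.bar ((f : FormalMap (ZW p)) * F) * swap p).toFun i
    rw [map_mul, mul_assoc]
    rfl

/-- Reality of `G` is what makes the conjugate half of the pairing transform by the same
substitution as the holomorphic half. -/
theorem subst_pairing_mul {F G : FormalMap (ZW p)} (hG : IsReal G)
    (r : MvPowerSeries (Ambient p) ℂ) :
    subst (pairing (F * G)) r = subst G.toFun (subst (pairing F) r) := by
  rw [subst_comp_subst_apply (hasSubst_pairing F) G.hasSubst]
  congr 1
  ext1 i
  rcases i with i | i
  · rfl
  · change (FormalMap.bar (F * G) * swap p).toFun i = (FormalMap.bar F * swap p * G).toFun i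
    rw [map_mul, mul_assoc, hG.bar_mul_swap, mul_assoc]

/-- The embedding of the variables `(z', w')` into those of the ambient space. -/
def incl (p : ℕ) : ZW p → Ambient p :=
  Sum.elim (fun i => Sum.inl (Sum.inl i)) fun i => Sum.inr (Sum.inl i)

/-- The right-hand sides of the defining equations, in the variables of the ambient space. -/
def graphFun (M : FormalSubmanifold p) : Fin p ⊕ Fin p → MvPowerSeries (Ambient p) ℂ :=
  Sum.elim (fun j => subst (fun i => X (incl p i) : ZW p → MvPowerSeries (Ambient p) ℂ) (M.E j))
    fun j => subst (fun i => X (incl p i.swap) : ZW p → MvPowerSeries (Ambient p) ℂ) (conj (M.E j))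

/-- The variables `z''` and `w''`. -/
def normalVar (p : ℕ) : Fin p ⊕ Fin p → Ambient p :=
  Sum.elim (fun j => Sum.inl (Sum.inr j)) fun j => Sum.inr (Sum.inr j)

theorem ideal_eq_span (M : FormalSubmanifold p) :
    M.ideal = Ideal.span (Set.range fun j => X (normalVar p j) - M.graphFun j) := by
  have h1 : (Sum.elim (fun i => X (Sum.inl (Sum.inl i))) (fun i => X (Sum.inr (Sum.inl i))) :
      ZW p → MvPowerSeries (Ambient p) ℂ) = fun i => X (incl p i) := by
    ext1 i
    rcases i with i | i <;> rfl
  have h2 : (Sum.elim (fun i => X (Sum.inr (Sum.inl i))) (fun i => X (Sum.inl (Sum.inl i))) :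
      ZW p → MvPowerSeries (Ambient p) ℂ) = fun i => X (incl p i.swap) := by
    ext1 i
    rcases i with i | i <;> rfl
  rw [ideal, h1, h2]
  congr 1
  ext f
  simp only [Set.mem_union, Set.mem_range, Sum.exists]
  rfl

theorem constantCoeff_E (M : FormalSubmanifold p) (j : Fin p) : constantCoeff (M.E j) = 0 :=
  M.param.map_zero (Sum.inr j)

theorem constantCoeff_graphFun (M : FormalSubmanifold p) (j : Fin p ⊕ Fin p) :
    constantCoeff (M.graphFun j) = 0 := by
  rcases j with j | j
  · exact (constantCoeff_subst_of_zero (fun _ => constantCoeff_X _) _).trans (M.constantCoeff_E j)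
  · exact (constantCoeff_subst_of_zero (fun _ => constantCoeff_X _) _).trans
      (FormalMap.map_zero (FormalMap.bar M.param) (Sum.inr j))

/-- The substitution of the `(z', w')`-variables by themselves fixes the right-hand sides. -/
theorem subst_graphFun (M : FormalSubmanifold p) {a : Ambient p → MvPowerSeries (Ambient p) ℂ}
    (ha : HasSubst a) (h : ∀ i, a (incl p i) = X (incl p i)) (j : Fin p ⊕ Fin p) :
    subst a (M.graphFun j) = M.graphFun j := by
  rcases j with j | j
  · refine (subst_comp_subst_apply (hasSubst_X_comp _) ha _).trans ?_
    simp only [subst_X ha, h]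
    rfl
  · refine (subst_comp_subst_apply (hasSubst_X_comp _) ha _).trans ?_
    simp only [subst_X ha, h]
    rfl

theorem pairing_param_incl (M : FormalSubmanifold p) (i : ZW p) :
    pairing M.param (incl p i) = X i := by
  rcases i with i | i
  · rfl
  · change subst (swap p).toFun (conj (X (Sum.inl i))) = _
    rw [conj, MvPowerSeries.map_X, subst_X (swap p).hasSubst]
    rfl

theorem subst_pairing_param_graphFun (M : FormalSubmanifold p) (j : Fin p ⊕ Fin p) :
    subst (pairing M.param) (M.graphFun j) = pairing M.param (normalVar p j) := by
  have ha := hasSubst_pairing M.param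
  rcases j with j | j
  · refine (subst_comp_subst_apply (hasSubst_X_comp _) ha _).trans ?_
    simp only [subst_X ha, pairing_param_incl]
    exact congrFun (subst_self (R := ℂ)) _
  · refine (subst_comp_subst_apply (hasSubst_X_comp _) ha _).trans ?_
    simp only [subst_X ha, pairing_param_incl]
    rfl

theorem subst_incl_pairing_param (M : FormalSubmanifold p) (j : Fin p ⊕ Fin p) :
    subst (fun i => X (incl p i) : ZW p → MvPowerSeries (Ambient p) ℂ)
      (pairing M.param (normalVar p j)) = M.graphFun j := by
  have hX := hasSubst_X_comp (incl p)
  have hs : (fun i => subst (fun k => X (incl p k) : ZW p → MvPowerSeries (Ambient p) ℂ)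
      ((swap p).toFun i)) = fun i => X (incl p i.swap) :=
    funext fun i => subst_X (R := ℂ) hX i.swap
  rcases j with j | j
  · rfl
  · have h := subst_comp_subst_apply (swap p).hasSubst hX (conj (M.E j))
    rw [hs] at h
    exact h

/-- The shear `(z'', w'') ↦ (z'' + ε E, w'' + ε \bar E)`. -/
def shear (M : FormalSubmanifold p) (ε : ℂ) : Ambient p → MvPowerSeries (Ambient p) ℂ :=
  Sum.elim (Sum.elim (fun i => X (Sum.inl (Sum.inl i)))
      fun j => X (Sum.inl (Sum.inr j)) + ε • M.graphFun (Sum.inl j))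
    (Sum.elim (fun i => X (Sum.inr (Sum.inl i)))
      fun j => X (Sum.inr (Sum.inr j)) + ε • M.graphFun (Sum.inr j))

theorem shear_incl (M : FormalSubmanifold p) (ε : ℂ) (i : ZW p) :
    M.shear ε (incl p i) = X (incl p i) := by
  rcases i with i | i <;> rfl

theorem shear_normalVar (M : FormalSubmanifold p) (ε : ℂ) (j : Fin p ⊕ Fin p) :
    M.shear ε (normalVar p j) = X (normalVar p j) + ε • M.graphFun j := by
  rcases j with j | j <;> rfl

theorem ambient_cases (i : Ambient p) : (∃ k, i = incl p k) ∨ ∃ j, i = normalVar p j := by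
  rcases i with (i | i) | (i | i)
  · exact Or.inl ⟨Sum.inl i, rfl⟩
  · exact Or.inr ⟨Sum.inl i, rfl⟩
  · exact Or.inl ⟨Sum.inr i, rfl⟩
  · exact Or.inr ⟨Sum.inr i, rfl⟩

theorem hasSubst_shear (M : FormalSubmanifold p) (ε : ℂ) : HasSubst (M.shear ε) := by
  refine hasSubst_of_constantCoeff_zero fun i => ?_
  rcases ambient_cases i with ⟨k, rfl⟩ | ⟨j, rfl⟩
  · rw [shear_incl, constantCoeff_X]
  · rw [shear_normalVar, map_add, constantCoeff_X, constantCoeff_smul, constantCoeff_graphFun,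
      smul_zero, add_zero]

theorem subst_shear_neg_shear (M : FormalSubmanifold p) (r : MvPowerSeries (Ambient p) ℂ) :
    subst (M.shear (-1)) (subst (M.shear 1) r) = r := by
  rw [subst_comp_subst_apply (M.hasSubst_shear 1) (M.hasSubst_shear (-1))]
  refine Eq.trans ?_ (congrFun (subst_self (R := ℂ)) r)
  congr 1
  ext1 i
  have h := M.hasSubst_shear (-1)
  rcases ambient_cases i with ⟨k, rfl⟩ | ⟨j, rfl⟩
  · rw [shear_incl, subst_X h, shear_incl]
  · rw [shear_normalVar, subst_add h, subst_X h, subst_smul h, M.subst_graphFun h (M.shear_incl _),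
      shear_normalVar]
    simp

/-- The ideal of `M` consists of the power series that vanish on the complexification of `M`. -/
theorem mem_ideal_iff (M : FormalSubmanifold p) (r : MvPowerSeries (Ambient p) ℂ) :
    r ∈ M.ideal ↔ subst (pairing M.param) r = 0 := by
  classical
  have hP := hasSubst_pairing M.param
  rw [ideal_eq_span]
  constructor
  · intro hr
    have : Ideal.span (Set.range fun j => X (normalVar p j) - M.graphFun j) ≤
        RingHom.ker (substAlgHom hP (R := ℂ)) := by
      rw [Ideal.span_le]
      rintro _ ⟨j, rfl⟩
      rw [SetLike.mem_coe, RingHom.mem_ker, substAlgHom_apply, subst_sub hP, subst_X hP,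
        subst_pairing_param_graphFun, sub_self]
    have := this hr
    rwa [RingHom.mem_ker, substAlgHom_apply] at this
  · intro hr
    -- The shear straightens the complexification of $M$ to $z''=w''=0$. The transformed series
    -- vanishes there, so it lies in the ideal of the variables $z'',w''$, and shearing back turns
    -- these into the generators of the ideal of $M$.
    set g := subst (M.shear 1) r with hg
    -- Rescaling by `a` sets the normal variables to zero and keeps $z'$ and $w'$.
    let a : Ambient p → ℂ := Sum.elim (Sum.elim 1 0) (Sum.elim 1 0)
    have ha1 : ∀ i, a (incl p i) = 1 := by rintro (i | i) <;> rfl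
    have ha0 : ∀ j, a (normalVar p j) = 0 := by rintro (j | j) <;> rfl
    have hX := hasSubst_X_comp (incl p)
    have hax : HasSubst (a • X : Ambient p → MvPowerSeries (Ambient p) ℂ) := HasSubst.smul_X a
    have hag : rescale a g = 0 := by
      rw [rescale_eq_subst, hg, subst_comp_subst_apply (M.hasSubst_shear 1) hax]
      have h0 : subst (fun i => X (incl p i) : ZW p → MvPowerSeries (Ambient p) ℂ)
          (subst (pairing M.param) r) = 0 := by
        rw [hr, ← substAlgHom_apply hX, map_zero]
      rw [subst_comp_subst_apply hP hX] at h0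
      rw [← h0]
      congr 1
      ext1 i
      have hgraph : ∀ j, subst (a • X : Ambient p → MvPowerSeries (Ambient p) ℂ) (M.graphFun j) =
          M.graphFun j := M.subst_graphFun hax fun i => by
        rw [Pi.smul_apply', ha1, one_smul]
      rcases ambient_cases i with ⟨k, rfl⟩ | ⟨j, rfl⟩
      · rw [shear_incl, subst_X hax, Pi.smul_apply', ha1, one_smul, pairing_param_incl, subst_X hX]
      · rw [shear_normalVar, subst_add hax, subst_X hax, Pi.smul_apply', ha0, zero_smul, zero_add,
          one_smul, hgraph,
          subst_incl_pairing_param]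
    have hspan : g ∈ Ideal.span ((fun i => (X i : MvPowerSeries (Ambient p) ℂ)) ''
        (Finset.univ.image (normalVar p) : Finset (Ambient p))) := by
      refine mem_span_X_of_coeff_eq_zero _ fun m hm => ?_
      have h1 := congrArg (coeff m) hag
      rw [coeff_rescale, Finsupp.prod_fintype _ _ (by simp), coeff_zero, Finset.prod_eq_one,
        one_mul] at h1
      · exact h1
      · intro i _
        rcases ambient_cases i with ⟨k, rfl⟩ | ⟨j, rfl⟩
        · rw [ha1, one_pow]
        · rw [hm _ (Finset.mem_image_of_mem _ (Finset.mem_univ j)), pow_zero]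
    rw [← M.subst_shear_neg_shear r, ← hg]
    refine Ideal.span_mono ?_ (subst_mem_span (M.hasSubst_shear (-1)) hspan)
    rintro _ ⟨_, ⟨i, hi, rfl⟩, rfl⟩
    obtain ⟨j, -, rfl⟩ := Finset.mem_image.mp hi
    refine ⟨j, ?_⟩
    change _ = subst (M.shear (-1)) (X (normalVar p j) : MvPowerSeries (Ambient p) ℂ)
    rw [subst_X (M.hasSubst_shear (-1)), shear_normalVar, neg_one_smul]
    exact sub_eq_add_neg _ _

/-- A holomorphic map `f` maps `M` to `M'` if and only if it lifts to a map of the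
parametrizations that commutes with `ρ₀`. -/
theorem mapsInto_iff (f : FormalBihol (Fin p ⊕ Fin p)) (M M' : FormalSubmanifold p) :
    MapsInto f M M' ↔
      ∃ G, IsReal G ∧ (f : FormalMap (ZW p)) * M.param = M'.param * G := by
  have h0 : MapsInto f M M' ↔ ∀ r ∈ M'.ideal,
      subst (pairing ((f : FormalMap (ZW p)) * M.param)) r = 0 := by
    simp only [MapsInto, mem_ideal_iff M, subst_pairing_complexify]
  rw [h0]
  constructor
  · intro h
    set F := (f : FormalMap (ZW p)) * M.param
    -- The $z'$-components of the lift are forced, as $(z',E')$ keeps $z'$; the conjugate half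
    -- supplies the rest.
    refine ⟨realify F, isReal_realify F, FormalMap.ext_apply ?_⟩
    have hG := (realify F).hasSubst
    rintro (i | j)
    · exact (subst_X (R := ℂ) hG (Sum.inl i)).symm
    · have hmem : X (normalVar p (Sum.inl j)) - M'.graphFun (Sum.inl j) ∈ M'.ideal := by
        rw [ideal_eq_span]
        exact Ideal.subset_span ⟨Sum.inl j, rfl⟩
      have hF := hasSubst_pairing F
      have h1 := h _ hmem
      rw [subst_sub hF, subst_X hF, sub_eq_zero] at h1
      refine Eq.trans h1 ((subst_comp_subst_apply (hasSubst_X_comp _) hF _).trans ?_)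
      simp only [subst_X hF]
      change _ = subst (realify F).toFun (M'.E j)
      congr 1
      ext1 i
      rcases i with i | i <;> rfl
  · rintro ⟨G, hG, hfG⟩ r hr
    rw [hfG, subst_pairing_mul hG, (mem_ideal_iff M' r).mp hr, ← substAlgHom_apply G.hasSubst,
      map_zero]

end FormalSubmanifold

theorem exists_perm_of_range_subset {ι α : Type} [Finite ι] {f g : ι → α}
    (hf : Function.Injective f) (h : ∀ i, f i ∈ Set.range g) :
    ∃ e : Equiv.Perm ι, ∀ i, f i = g (e i) := by
  choose e he using h
  have hinj : Function.Injective e := fun i j hij => hf (by rw [← he, ← he, hij])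
  exact ⟨Equiv.ofBijective e (Finite.injective_iff_bijective.mp hinj), fun i => (he i).symm⟩

section Reality

variable {p : ℕ}

theorem isReal_one : IsReal (1 : FormalMap (ZW p)) := by
  rw [IsReal, one_mul, map_one, mul_one]

theorem IsReal.inv {F : FormalBihol (ZW p)} (hF : IsReal (F : FormalMap (ZW p))) :
    IsReal ((F⁻¹ : FormalBihol (ZW p)) : FormalMap (ZW p)) := by
  rw [← intertwines_rho0_iff, Intertwines] at hF ⊢
  rw [map_inv, inv_mul_eq_iff_eq_mul, ← mul_assoc, hF, mul_inv_cancel_right]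

end Reality

theorem conjFlip_mul_inv {p : ℕ} (U F : FormalBihol (ZW p)) (s : Fin p → ℤˣ) :
    conjFlip (U * F⁻¹) s = F * conjFlip U s * F⁻¹ := by
  rw [conjFlip_apply, conjFlip_apply]
  group

/-! ### Equivalence of manifolds and of families -/

namespace FormalSubmanifold

variable {p : ℕ} {M M' : FormalSubmanifold p}

/-- Both $f$ and $f^{-1}$ lift to the parametrizations. The lifts are mutually inverse because lifts
that commute with $\rho_0$ are unique, and conjugation by the lift then transports the relation
defining deck transformations. -/
theorem exists_lift_of_formallyEquivalent (h : M.FormallyEquivalent M') :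
    ∃ F : FormalBihol (ZW p), IsReal (F : FormalMap (ZW p)) ∧
      ∀ τ, τ ∈ M.deck ↔ F * τ * F⁻¹ ∈ M'.deck := by
  obtain ⟨f, hf, hf'⟩ := h
  obtain ⟨G, hG, hfG⟩ := (mapsInto_iff f M M').mp hf
  obtain ⟨G', hG', hfG'⟩ := (mapsInto_iff f⁻¹ M' M).mp hf'
  -- Since $(z',E)$ keeps $z'$, such an `H` keeps $z'$, and reality makes it keep $w'$ too.
  have key : ∀ {N : FormalSubmanifold p} {H : FormalMap (ZW p)}, IsReal H →
      N.param * H = N.param → H = 1 := by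
    intro N H hH hNH
    refine hH.ext isReal_one fun i => ?_
    have h1 := congrFun (congrArg FormalMap.toFun hNH) (Sum.inl i)
    exact (subst_X (R := ℂ) H.hasSubst (Sum.inl i)).symm.trans h1
  have h1 : G' * G = 1 := key (N := M) (hG'.mul hG) (by
    rw [← mul_assoc, ← hfG', mul_assoc, ← hfG, Units.inv_mul_cancel_left])
  have h2 : G * G' = 1 := key (N := M') (hG.mul hG') (by
    rw [← mul_assoc, ← hfG, mul_assoc, ← hfG', Units.mul_inv_cancel_left])
  refine ⟨⟨G, G', h2, h1⟩, hG, fun τ => ?_⟩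
  rw [mem_deck_iff, mem_deck_iff]
  change _ ↔ M'.param * (G * τ * G') = M'.param
  rw [← mul_assoc, ← mul_assoc, ← hfG]
  constructor
  · intro h
    rw [mul_assoc _ M.param, h, hfG, mul_assoc, h2, mul_one]
  · intro h
    have h3 := congrArg (· * G) h
    rw [mul_assoc, h1, mul_one, ← hfG, mul_assoc, Units.mul_right_inj] at h3
    exact h3

/-- The map $(z',E')\circ F$ is invariant under the deck group of $M$, so it descends through
$(z',E)$; the same holds for $F^{-1}$, and cancellation shows that the two descended maps are
inverse to each other. -/
theorem formallyEquivalent_of_lift (hM : M.ConditionD) (hM' : M'.ConditionD)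
    {F : FormalBihol (ZW p)} (hF : IsReal (F : FormalMap (ZW p)))
    (h : ∀ τ, τ ∈ M.deck ↔ F * τ * F⁻¹ ∈ M'.deck) : M.FormallyEquivalent M' := by
  obtain ⟨f, hf⟩ := exists_eq_mul_param hM (F := M'.param * (F : FormalMap (ZW p))) (by
    intro τ hτ
    rw [h, mem_deck_iff, Units.val_mul, Units.val_mul, ← mul_assoc, ← mul_assoc,
      Units.mul_inv_eq_iff_eq_mul] at hτ
    exact hτ)
  obtain ⟨g, hg⟩ := exists_eq_mul_param hM'
    (F := M.param * ((F⁻¹ : FormalBihol (ZW p)) : FormalMap (ZW p))) (by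
    intro τ hτ
    have h1 : F⁻¹ * τ * F ∈ M.deck := by
      rw [h]
      convert! hτ using 1
      group
    rw [mem_deck_iff, Units.val_mul, Units.val_mul, ← mul_assoc, ← mul_assoc] at h1
    rw [Units.eq_mul_inv_iff_mul_eq, h1])
  have hgf : g * f = 1 := mul_param_cancel hM (by
    rw [mul_assoc, ← hf, ← mul_assoc, ← hg, mul_assoc, Units.inv_mul, mul_one, one_mul])
  have hfg : f * g = 1 := mul_param_cancel hM' (by
    rw [mul_assoc, ← hg, ← mul_assoc, ← hf, mul_assoc, Units.mul_inv, mul_one, one_mul])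
  refine ⟨⟨f, g, hfg, hgf⟩, ?_, ?_⟩
  · rw [mapsInto_iff]
    exact ⟨F, hF, hf.symm⟩
  · rw [mapsInto_iff]
    exact ⟨_, hF.inv, hg.symm⟩

/-- Formal equivalence of manifolds amounts to equivalence of the associated families. -/
theorem formallyEquivalent_iff_familyEquivalent (hM : M.ConditionD) (hM' : M'.ConditionD)
    {τ τ' : Fin p → FormalBihol (ZW p)} (hτ : M.IsAssociatedFamily τ)
    (hτ' : M'.IsAssociatedFamily τ') :
    M.FormallyEquivalent M' ↔ FamilyEquivalent τ (rho0 p) τ' (rho0 p) := by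
  constructor
  · intro h
    obtain ⟨F, hF, hdeck⟩ := exists_lift_of_formallyEquivalent h
    refine ⟨F, (intertwines_rho0_iff F).mpr hF, ?_⟩
    obtain ⟨U, -, hU⟩ := exists_deck_eq_range hM
    -- Normalizing coordinates are transported by `F`, so the reflections of `M` are conjugated to
    -- those of `M'`.
    have hU' : M'.deck = (conjFlip (U * F⁻¹)).range := by
      ext g
      have h1 := hdeck (F⁻¹ * g * F)
      have h2 : F * (F⁻¹ * g * F) * F⁻¹ = g := by group
      rw [h2, hU] at h1
      rw [← h1, MonoidHom.mem_range, MonoidHom.mem_range]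
      refine exists_congr fun s => ?_
      rw [conjFlip_mul_inv, mul_inv_eq_iff_eq_mul, mul_assoc F⁻¹, eq_inv_mul_iff_mul_eq]
    refine exists_perm_of_range_subset (f := fun j => F * τ j * F⁻¹) (fun i j hij => ?_)
      fun j => ?_
    · exact hτ.1 (mul_left_cancel (mul_right_cancel hij))
    · rw [hτ'.range_eq hU']
      obtain ⟨k, hk⟩ : τ j ∈ Set.range (reflections U) := hτ.range_eq hU ▸ ⟨j, rfl⟩
      refine ⟨k, ?_⟩
      rw [← hk, reflections, reflections, conjFlip_mul_inv]
  · rintro ⟨F, hF, e, he⟩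
    refine formallyEquivalent_of_lift hM hM' ((intertwines_rho0_iff F).mp hF) fun g => ?_
    have hmap : M'.deck = M.deck.map (MulAut.conj F).toMonoidHom := by
      rw [← hτ.2.1, ← hτ'.2.1, MonoidHom.map_closure, ← Set.range_comp]
      congr 1
      rw [← e.surjective.range_comp τ']
      congr 1
      ext1 j
      rw [Function.comp_apply, ← he]
      rfl
    rw [hmap]
    exact (Subgroup.mem_map_iff_mem (MulAut.conj F).injective).symm

end FormalSubmanifold

/-! ### Commuting involutions with transversal fixed-point sets -/

section Coordinates

variable {σ : Type} [Fintype σ] [DecidableEq σ]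

/-- The subspace on which the coordinates in `J` vanish. -/
def coordSubspace (J : Finset σ) : Submodule ℂ (σ → ℂ) :=
  ⨅ i ∈ (J : Set σ), LinearMap.ker (LinearMap.proj i : (σ → ℂ) →ₗ[ℂ] ℂ)

omit [Fintype σ] [DecidableEq σ] in
theorem mem_coordSubspace {J : Finset σ} {y : σ → ℂ} :
    y ∈ coordSubspace J ↔ ∀ i ∈ J, y i = 0 := by
  simp [coordSubspace]

theorem finrank_coordSubspace (J : Finset σ) :
    Module.finrank ℂ (coordSubspace J) + J.card = Fintype.card σ := by
  have e := LinearMap.iInfKerProjEquiv ℂ (fun _ : σ => ℂ) (I := ((Jᶜ : Finset σ) : Set σ))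
    (J := (J : Set σ)) (by rw [Finset.disjoint_coe]; exact disjoint_compl_left)
    (by rw [← Finset.coe_union, Finset.union_comm, Finset.union_compl, Finset.coe_univ])
  rw [coordSubspace, e.finrank_eq, Module.finrank_fintype_fun_eq_card]
  rw [← Finset.card_compl_add_card J]
  congr 1
  exact Fintype.card_coe Jᶜ

theorem finrank_comap_coordSubspace {A : Matrix σ σ ℂ} (hA : IsUnit A) (J : Finset σ) :
    Module.finrank ℂ ((coordSubspace J).comap (Matrix.toLin' A)) + J.card = Fintype.card σ := by
  let e : (σ → ℂ) ≃ₗ[ℂ] (σ → ℂ) := LinearEquiv.ofBijective (Matrix.toLin' A)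
    ⟨Matrix.mulVec_injective_iff_isUnit.mpr hA, Matrix.mulVec_surjective_iff_isUnit.mpr hA⟩
  have h : ((coordSubspace J).comap (Matrix.toLin' A)).map (e : (σ → ℂ) →ₗ[ℂ] (σ → ℂ)) =
      coordSubspace J := Submodule.map_comap_eq_of_surjective e.surjective _
  have h1 := finrank_coordSubspace J
  rwa [← h, LinearEquiv.finrank_map_eq] at h1

/-- The differentials of the components of $F-\mathrm{id}$ form $LF-1$. Only one inclusion is
immediate, since the radical may contain further linear terms; later a dimension count gives
equality. -/
theorem tangentSpace_fixIdeal_le (F : FormalBihol σ) :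
    tangentSpace (fixIdeal F) ≤ LinearMap.eqLocus (Matrix.toLin' (linearPart F)) LinearMap.id := by
  intro v hv
  rw [LinearMap.mem_eqLocus, LinearMap.id_apply, Matrix.toLin'_apply]
  ext i
  have hmem : comps F i - X i ∈ fixIdeal F := Ideal.le_radical (Ideal.subset_span ⟨i, rfl⟩)
  rw [tangentSpace, Submodule.mem_iInf] at hv
  have h := (Submodule.mem_iInf _).mp (hv (comps F i - X i)) hmem
  rw [LinearMap.mem_ker, differential_apply, linCoeff_sub, sub_dotProduct, linCoeff_X,
    single_one_dotProduct, sub_eq_zero] at h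
  exact h

omit [DecidableEq σ] in
theorem tangentSpace_fixIdeal_one : tangentSpace (fixIdeal (1 : FormalBihol σ)) = ⊤ := by
  rw [fixIdeal_one, tangentSpace, eq_top_iff]
  intro v _
  rw [Submodule.mem_iInf]
  intro r
  rw [Submodule.mem_iInf]
  intro hr
  rw [Ideal.mem_bot] at hr
  rw [hr, LinearMap.mem_ker, differential_apply]
  have : linCoeff (0 : MvPowerSeries σ ℂ) = 0 := by
    ext k
    simp [linCoeff]
  rw [this, zero_dotProduct]

theorem eqLocus_eq_comap_coordSubspace {A L : Matrix σ σ ℂ} (hA : IsUnit A) {s : σ → ℂ}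
    (h : A * L = Matrix.diagonal s * A) :
    LinearMap.eqLocus (Matrix.toLin' L) LinearMap.id =
      (coordSubspace (Finset.univ.filter fun i => s i ≠ 1)).comap (Matrix.toLin' A) := by
  ext v
  rw [LinearMap.mem_eqLocus, Submodule.mem_comap, mem_coordSubspace, LinearMap.id_apply,
    Matrix.toLin'_apply, Matrix.toLin'_apply,
    ← (Matrix.mulVec_injective_iff_isUnit.mpr hA).eq_iff, Matrix.mulVec_mulVec, h,
    ← Matrix.mulVec_mulVec, funext_iff]
  refine forall_congr' fun i => ?_
  rw [Matrix.mulVec_diagonal, Finset.mem_filter]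
  constructor
  · rintro h1 ⟨-, hs⟩
    by_contra h0
    exact hs (mul_right_cancel₀ h0 (by rw [h1, one_mul]))
  · intro h1
    by_cases hs : s i = 1
    · rw [hs, one_mul]
    · rw [h1 ⟨Finset.mem_univ _, hs⟩, mul_zero]

end Coordinates

section Signs

variable {G : Type} [Group G]

/-- The homomorphism from `{±1}` that maps `-1` to an involution. -/
def signHom (g : G) (hg : g * g = 1) : ℤˣ →* G where
  toFun s := if s = 1 then 1 else g
  map_one' := by simp
  map_mul' s t := by
    rcases Int.units_eq_one_or s with rfl | rfl <;> rcases Int.units_eq_one_or t with rfl | rfl <;>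
      simp [hg]

theorem signHom_neg_one (g : G) (hg : g * g = 1) : signHom g hg (-1) = g := by
  simp [signHom]

theorem exists_hom_of_commuting_involutions {p : ℕ} (τ : Fin p → G) (h : ∀ j, τ j * τ j = 1)
    (hc : ∀ i j, τ i * τ j = τ j * τ i) :
    ∃ ψ : (Fin p → ℤˣ) →* G, ∀ j, ψ (signAt j) = τ j := by
  have hpair : Pairwise fun i j => ∀ s t : ℤˣ,
      Commute (signHom (τ i) (h i) s) (signHom (τ j) (h j) t) := by
    intro i j _ s t
    rcases Int.units_eq_one_or s with rfl | rfl
    · rw [map_one]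
      exact Commute.one_left _
    · rcases Int.units_eq_one_or t with rfl | rfl
      · rw [map_one]
        exact Commute.one_right _
      · rw [signHom_neg_one, signHom_neg_one]
        exact (commute_iff_eq _ _).mpr (hc i j)
  refine ⟨MonoidHom.noncommPiCoprod (fun j => signHom (τ j) (h j)) hpair, fun j => ?_⟩
  rw [signAt, MonoidHom.noncommPiCoprod_mulSingle, signHom_neg_one]

end Signs

variable {p : ℕ}

/-- Commuting involutions whose fixed-point sets have transversal tangent hyperplanes are the sign
changes of single coordinates in suitable formal coordinates. -/
theorem exists_eq_reflections (τ : Fin p → FormalBihol (ZW p)) (h2 : ∀ j, τ j * τ j = 1)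
    (hcomm : ∀ i j, τ i * τ j = τ j * τ i)
    (hhyp : ∀ j, Module.finrank ℂ (tangentSpace (fixIdeal (τ j))) + 1 = 2 * p)
    (htrans : Module.finrank ℂ
      (⨅ j, tangentSpace (fixIdeal (τ j)) : Submodule ℂ (ZW p → ℂ)) + p = 2 * p) :
    ∃ U : FormalBihol (ZW p), ∀ j, τ j = reflections U j := by
  have hcardσ : Fintype.card (ZW p) = 2 * p := by simp [two_mul]
  obtain ⟨ψ, hψ⟩ := exists_hom_of_commuting_involutions τ h2 hcomm
  let L : (Fin p → ℤˣ) →* Matrix (ZW p) (ZW p) ℂ :=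
    { toFun := fun s => linearPart (ψ s)
      map_one' := by rw [map_one, linearPart_one]
      map_mul' := fun s t => by rw [map_mul, linearPart_mul] }
  obtain ⟨A, χ, hA, hAχ⟩ := exists_simultaneous_diagonalization signs_mul_self L
  have hχ : ∀ i j, χ i (signAt j) = 1 ∨ χ i (signAt j) = -1 := by
    intro i j
    rw [← mul_self_eq_one_iff, ← map_mul, signs_mul_self, map_one]
  have hAτ : ∀ j, A * linearPart (τ j) = Matrix.diagonal (fun i => χ i (signAt j)) * A := by
    intro j
    rw [← hψ j]
    exact hAχ (signAt j)
  let N : Fin p → Finset (ZW p) := fun j => Finset.univ.filter fun i => χ i (signAt j) ≠ 1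
  have hN : ∀ j i, i ∈ N j ↔ χ i (signAt j) ≠ 1 := fun j i => by simp [N]
  have hle : ∀ j, tangentSpace (fixIdeal (τ j)) ≤
      (coordSubspace (N j)).comap (Matrix.toLin' A) := fun j => by
    rw [← eqLocus_eq_comap_coordSubspace hA (hAτ j)]
    exact tangentSpace_fixIdeal_le (τ j)
  -- The tangent hyperplane lies in the space fixed by the linear part, so at most one eigenvalue
  -- differs from 1. If none did, the linearizing coordinates would be invariant, $\tau_j$ would be
  -- the identity, and its tangent space would be everything.
  have hNcard : ∀ j, (N j).card = 1 := by
    intro j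
    have h1 := Submodule.finrank_mono (hle j)
    have h3 := finrank_comap_coordSubspace hA (N j)
    have h4 := hhyp j
    have hne : (N j).card ≠ 0 := by
      intro h0
      rw [Finset.card_eq_zero] at h0
      obtain ⟨U, -, hU⟩ := exists_diagonalizing_coordinates ψ χ hA hAχ
      have h5 : U * τ j = U := by
        refine bihol_ext fun i => ?_
        have h6 : χ i (signAt j) = 1 := by
          by_contra hcon
          have := (hN j i).mpr hcon
          rw [h0] at this
          simp at this
        rw [comps_mul, ← hψ, hU, h6, one_smul]
      rw [mul_eq_left.mp h5, tangentSpace_fixIdeal_one, finrank_top,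
        Module.finrank_fintype_fun_eq_card] at h4
      omega
    omega
  have heq : ∀ j, tangentSpace (fixIdeal (τ j)) =
      (coordSubspace (N j)).comap (Matrix.toLin' A) := by
    intro j
    refine Submodule.eq_of_le_of_finrank_eq (hle j) ?_
    have h3 := finrank_comap_coordSubspace hA (N j)
    have h4 := hhyp j
    have h5 := hNcard j
    omega
  choose ι hι using fun j => Finset.card_eq_one.mp (hNcard j)
  have hιN : ∀ i j, χ i (signAt j) ≠ 1 ↔ i = ι j := by
    intro i j
    rw [← hN, hι, Finset.mem_singleton]
  have hinf : (⨅ j, tangentSpace (fixIdeal (τ j)) : Submodule ℂ (ZW p → ℂ)) =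
      (coordSubspace (Finset.univ.image ι)).comap (Matrix.toLin' A) := by
    ext v
    simp only [heq, Submodule.mem_iInf, Submodule.mem_comap, mem_coordSubspace, hι]
    simp
  -- The intersection of the hyperplanes has codimension equal to the number of distinct `ι j`;
  -- transversality makes this number `p`.
  have hιinj : Function.Injective ι := by
    have h1 := finrank_comap_coordSubspace hA (Finset.univ.image ι)
    rw [← hinf] at h1
    have h3 : (Finset.univ.image ι).card = (Finset.univ : Finset (Fin p)).card := by
      rw [Finset.card_univ, Fintype.card_fin]
      omega
    rw [Finset.card_image_iff] at h3
    rwa [Finset.coe_univ, Set.injOn_univ] at h3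
  -- The permutation moves the eigencoordinate negated by $\tau_j$ into the slot of $w_j$.
  obtain ⟨π, hπ⟩ := Equiv.Perm.exists_extending_pair (Sum.inr : Fin p → ZW p) ι
    Sum.inr_injective hιinj
  obtain ⟨U, -, hU⟩ := exists_diagonalizing_coordinates ψ (fun i => χ (π i))
    (A := A.submatrix π id) (by
      rw [← Matrix.linearIndependent_rows_iff_isUnit] at hA ⊢
      exact hA.comp π π.injective) (fun k => by
      ext i j
      have := congrFun (congrFun (hAχ k) (π i)) j
      rw [Matrix.diagonal_mul] at this ⊢
      exact this)
  refine ⟨U, fun j => ?_⟩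
  rw [reflections, conjFlip_apply, mul_assoc, eq_inv_mul_iff_mul_eq]
  refine bihol_ext ?_
  rintro (i | k)
  · rw [comps_flip_mul_inl, comps_mul, ← hψ, hU]
    have : χ (π (Sum.inl i)) (signAt j) = 1 := by
      by_contra hcon
      rw [← ne_eq, hιN, ← hπ] at hcon
      simpa using π.injective hcon
    rw [this, one_smul]
  · rw [comps_flip_mul_inr, comps_mul, ← hψ, hU, hπ]
    congr 1
    by_cases hkj : k = j
    · rw [hkj, sgn_signAt_self]
      exact (hχ _ _).resolve_left ((hιN _ _).mpr rfl)
    · rw [sgn_signAt_of_ne hkj]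
      by_contra hcon
      exact hkj (hιinj ((hιN _ _).mp hcon))

theorem bar_flip (s : Fin p → ℤˣ) : bar (flip s) = flip s := by
  refine bihol_ext ?_
  rintro (i | k)
  · exact MvPowerSeries.map_X _ _
  · change conj (comps (flip s) (Sum.inr k)) = _
    rw [comps_flip_inr, conj, MvPowerSeries.smul_eq_C_mul, map_mul, MvPowerSeries.map_X,
      MvPowerSeries.map_C]
    simp [sgn]

theorem AntiInvolution.bar_mul_R {σ : Type} [Finite σ] (ρ : AntiInvolution σ) :
    bar ρ.R * ρ.R = 1 := mul_eq_one_comm.mp ρ.invol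

/-- A row of the linear part that is invariant under a family of maps is an invariant linear
function. -/
theorem dotProductEquiv_mem_linearInvariants {σ : Type} [Fintype σ] [DecidableEq σ]
    (𝓕 : Fin p → FormalBihol σ) {v : σ → ℂ}
    (hv : ∀ j, Matrix.vecMul v (linearPart (𝓕 j)) = v) :
    dotProductEquiv ℂ σ v ∈ linearInvariants 𝓕 := by
  rw [linearInvariants, Submodule.mem_iInf]
  intro j
  rw [LinearMap.mem_eqLocus]
  refine LinearMap.ext fun x => ?_
  change v ⬝ᵥ Matrix.toLin' (linearPart (𝓕 j)) x = v ⬝ᵥ x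
  rw [Matrix.toLin'_apply, Matrix.dotProduct_mulVec, hv]

/-- Coordinates `U` in which the maps of a family act by sign changes of the `w`-coordinates have
invariant `z`-components. -/
theorem vecMul_span_rows_inl {U : FormalBihol (ZW p)} {g : FormalBihol (ZW p)} {s : Fin p → ℤˣ}
    (h : U * g = flip s * U) {v : ZW p → ℂ}
    (hv : v ∈ Submodule.span ℂ (Set.range fun i : Fin p => linearPart U (Sum.inl i))) :
    Matrix.vecMul v (linearPart g) = v := by
  have hle : Submodule.span ℂ (Set.range fun i : Fin p => linearPart U (Sum.inl i)) ≤
      LinearMap.eqLocus (linearPart g).vecMulLinear LinearMap.id := by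
    rw [Submodule.span_le]
    rintro _ ⟨i, rfl⟩
    have h1 := congrArg linearPart h
    rw [linearPart_mul, linearPart_mul, linearPart_flip] at h1
    change Matrix.vecMul (linearPart U (Sum.inl i)) (linearPart g) = linearPart U (Sum.inl i)
    ext k
    have h2 := congrFun (congrFun h1 (Sum.inl i)) k
    rw [Matrix.diagonal_mul, Sum.elim_inl, Pi.one_apply, one_mul] at h2
    exact h2
  exact hle hv

/-- The coordinates `(z', w')` given by functions invariant under the `τ_j` and by the conjugates
of their compositions with `ρ`. -/
theorem exists_intertwining_coordinates (U : FormalBihol (ZW p)) (ρ : AntiInvolution (ZW p))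
    (hinv : linearInvariants (reflections U) ⊓
      linearInvariants (fun j => ρ.conjugate (reflections U j)) = ⊥) :
    ∃ Φ : FormalBihol (ZW p), (∀ i, comps Φ (Sum.inl i) = comps U (Sum.inl i)) ∧
      Intertwines Φ ρ (rho0 p) := by
  -- With $\rho(x)=R(\bar x)$ one has $\overline{U(\rho(x))}=\bar U(\bar R(x))$, so `W` is
  -- $U\circ\rho$ followed by conjugation. The involutions $\rho\tau_{1j}\rho$ act on it by the same
  -- sign changes as $\tau_{1j}$ on `U`.
  set W := bar U * bar ρ.R with hW
  have hUτ : ∀ j, U * reflections U j = flip (signAt j) * U := by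
    intro j
    rw [reflections, conjFlip_apply, mul_assoc, mul_inv_cancel_left]
  have hWτ : ∀ j, W * ρ.conjugate (reflections U j) = flip (signAt j) * W := by
    intro j
    have h1 := congrArg bar (hUτ j)
    rw [map_mul, map_mul, bar_flip] at h1
    rw [hW, AntiInvolution.conjugate, ← mul_assoc (flip _), ← h1]
    simp only [mul_assoc]
    rw [← mul_assoc (bar ρ.R), ρ.bar_mul_R, one_mul]
  let F : FormalMap (ZW p) := ⟨Sum.elim (fun i => comps U (Sum.inl i))
    (fun i => comps W (Sum.inl i)), by
      rintro (i | i)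
      · exact constantCoeff_comps _ _
      · exact constantCoeff_comps _ _⟩
  have hrow : ∀ V : FormalBihol (ZW p),
      LinearIndependent ℂ fun i : Fin p => linearPart V (Sum.inl i) := fun V =>
    (Matrix.linearIndependent_rows_iff_isUnit.mpr (isUnit_linearPart V)).comp Sum.inl
      Sum.inl_injective
  have hF : IsUnit F.jac := by
    rw [← Matrix.linearIndependent_rows_iff_isUnit]
    -- A common vector of the two row spans would be a linear function invariant under both
    -- families, hence zero; so the $2p$ rows are independent.
    have h1 := (hrow U).sum_type (hrow W) (by
      rw [Submodule.disjoint_def]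
      intro v hvU hvW
      have h2 : dotProductEquiv ℂ (ZW p) v ∈ linearInvariants (reflections U) ⊓
          linearInvariants (fun j => ρ.conjugate (reflections U j)) :=
        ⟨dotProductEquiv_mem_linearInvariants _ fun j => vecMul_span_rows_inl (hUτ j) hvU,
          dotProductEquiv_mem_linearInvariants _ fun j => vecMul_span_rows_inl (hWτ j) hvW⟩
      rw [hinv, Submodule.mem_bot] at h2
      exact (dotProductEquiv ℂ (ZW p)).map_eq_zero_iff.mp h2)
    convert! h1 using 1
    ext1 i
    rcases i with i | i <;> rfl
  obtain ⟨Φ, hΦ⟩ := F.isUnit_of_isUnit_jac hF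
  have hΦ' : comps Φ = F.toFun := by rw [comps, hΦ]
  refine ⟨Φ, fun i => by rw [hΦ']; rfl, ?_⟩
  have hbar : ∀ i, comps (bar Φ) i = conj (F.toFun i) := fun i => by rw [← hΦ']; rfl
  refine bihol_ext ?_
  have hswap : ∀ i, comps ((rho0 p).R * bar Φ) i = conj (F.toFun i.swap) := fun i =>
    (swap_mul_toFun _ i).trans (hbar _)
  rintro (i | i)
  · rw [hswap, comps_mul, hΦ']
    change comps (U * ρ.R) (Sum.inl i) = comps (bar W) (Sum.inl i)
    have h1 : ∀ G : FormalBihol (ZW p), bar (bar G) = G := fun G => Units.ext (bar_bar _)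
    rw [hW, map_mul, h1, h1]
  · rw [hswap, comps_mul, hΦ']
    change comps (W * ρ.R) (Sum.inl i) = comps (bar U) (Sum.inl i)
    rw [hW, mul_assoc, ρ.bar_mul_R, mul_one]

/-- The manifold `z'' = (B₁², …, Bₚ²)(z', \bar z')`, where `B` is the second half of `V`. -/
def squareManifold (V : FormalBihol (ZW p)) : FormalSubmanifold p where
  E j := comps V (Sum.inr j) ^ 2
  two_le_order _ := le_order_pow_of_constantCoeff_eq_zero 2 (constantCoeff_comps V _)

/-! ### Realization by manifolds $z''=B^2$ -/

section SquareManifold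

variable {V : FormalBihol (ZW p)}

theorem param_squareManifold (hV : ∀ i, comps V (Sum.inl i) = X (Sum.inl i)) :
    (squareManifold V).param = squareMap p * (V : FormalMap (ZW p)) := by
  refine FormalMap.ext_apply ?_
  rintro (i | j)
  · exact ((subst_X (R := ℂ) (hasSubst_comps V) _).trans (hV i)).symm
  · change comps V (Sum.inr j) ^ 2 = subst (comps V) (X (Sum.inr j) ^ 2 : MvPowerSeries (ZW p) ℂ)
    rw [subst_pow (hasSubst_comps V), subst_X (hasSubst_comps V)]

/-- Power series over a field form a domain, so $h_k^2=w_k^2$ leaves only $h_k=\pm w_k$. -/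
theorem exists_eq_flip {h : FormalBihol (ZW p)}
    (hh : squareMap p * (h : FormalMap (ZW p)) = squareMap p) : ∃ s, flip s = h := by
  have hinl : ∀ i, comps h (Sum.inl i) = X (Sum.inl i) := fun i =>
    (subst_X (R := ℂ) (hasSubst_comps h) (Sum.inl i)).symm.trans
      (congrFun (congrArg FormalMap.toFun hh) (Sum.inl i))
  have hinr : ∀ k, ∃ s : ℤˣ, comps h (Sum.inr k) = ((s : ℤ) : ℂ) • X (Sum.inr k) := by
    intro k
    have h1 : subst (comps h) (X (Sum.inr k) ^ 2 : MvPowerSeries (ZW p) ℂ) = X (Sum.inr k) ^ 2 :=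
      congrFun (congrArg FormalMap.toFun hh) (Sum.inr k)
    rw [subst_pow (hasSubst_comps h), subst_X (hasSubst_comps h), sq_eq_sq_iff_eq_or_eq_neg] at h1
    rcases h1 with h1 | h1
    · exact ⟨1, by simp [h1]⟩
    · exact ⟨-1, by simp [h1]⟩
  choose s hs using hinr
  refine ⟨s, bihol_ext ?_⟩
  rintro (i | k)
  · rw [hinl, comps_flip_inl]
  · rw [hs, comps_flip_inr]
    rfl

theorem deck_squareManifold (hV : ∀ i, comps V (Sum.inl i) = X (Sum.inl i)) :
    (squareManifold V).deck = (conjFlip V).range := by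
  ext g
  rw [FormalSubmanifold.mem_deck_iff, param_squareManifold hV, MonoidHom.mem_range]
  constructor
  · intro h
    obtain ⟨s, hs⟩ := exists_eq_flip (h := V * g * V⁻¹) (by
      rw [Units.val_mul, Units.val_mul, ← mul_assoc, ← mul_assoc, h, mul_assoc, Units.mul_inv,
        mul_one])
    refine ⟨s, ?_⟩
    rw [conjFlip_apply, hs]
    group
  · rintro ⟨s, rfl⟩
    rw [conjFlip_apply, Units.val_mul, Units.val_mul, mul_assoc, ← mul_assoc (V : FormalMap (ZW p)),
      Units.mul_inv_cancel_left, ← mul_assoc, squareMap_mul_flip]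

/-- Here $q_j(w)$ is the square of the $j$-th entry of the invertible $w'$-block of `V` applied to
$w$, which gives condition B; the deck group is a copy of $\{\pm1\}^p$. -/
theorem conditionD_squareManifold (hV : ∀ i, comps V (Sum.inl i) = X (Sum.inl i)) :
    (squareManifold V).ConditionD := by
  constructor
  · intro w hw
    apply Matrix.mulVec_injective_iff_isUnit.mpr (isUnit_wBlock hV)
    rw [Matrix.mulVec_zero]
    ext j
    have h := hw j
    rw [← (squareManifold V).coeff_subst_E j (FormalSubmanifold.constantCoeff_line w)
      (FormalSubmanifold.coeff_line_inl w) (FormalSubmanifold.coeff_line_inr w)] at h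
    change coeff _ (subst _ (comps V (Sum.inr j) ^ 2)) = 0 at h
    rw [subst_pow (FormalSubmanifold.hasSubst_line w), coeff_two_sq
      (by rw [constantCoeff_subst_of_zero (FormalSubmanifold.constantCoeff_line w),
        constantCoeff_comps]), FormalSubmanifold.coeff_subst_line_comps_inr] at h
    exact eq_zero_of_pow_eq_zero h
  · rw [deck_squareManifold hV,
      ← Nat.card_congr (MonoidHom.ofInjective (conjFlip_injective V)).toEquiv]
    simp

end SquareManifold

/-- Realization of abstract families of involutions. -/
theorem exists_realization (τ : Fin p → FormalBihol (ZW p)) (ρ : AntiInvolution (ZW p))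
    (h2 : ∀ j, τ j * τ j = 1) (hcomm : ∀ i j, τ i * τ j = τ j * τ i)
    (hhyp : ∀ j, Module.finrank ℂ (tangentSpace (fixIdeal (τ j))) + 1 = 2 * p)
    (htrans : Module.finrank ℂ
      (⨅ j, tangentSpace (fixIdeal (τ j)) : Submodule ℂ (ZW p → ℂ)) + p = 2 * p)
    (hinv : linearInvariants τ ⊓ linearInvariants (fun j => ρ.conjugate (τ j)) = ⊥) :
    ∃ (B : Fin p → MvPowerSeries (ZW p) ℂ) (M : FormalSubmanifold p),
      (∀ j, M.E j = B j ^ 2) ∧ M.ConditionD ∧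
        ∃ τ' : Fin p → FormalBihol (ZW p), M.IsAssociatedFamily τ' ∧
          FamilyEquivalent τ ρ τ' (rho0 p) := by
  obtain ⟨U, hU⟩ := exists_eq_reflections τ h2 hcomm hhyp htrans
  obtain rfl : τ = reflections U := funext hU
  obtain ⟨Φ, hΦ, hΦρ⟩ := exists_intertwining_coordinates U ρ hinv
  -- `Φ` and `U` share their first `p` components, so $U\Phi^{-1}$ keeps $z'$, and its reflections
  -- are the conjugates by `Φ` of those of `U`.
  have hV : ∀ i, comps (U * Φ⁻¹) (Sum.inl i) = X (Sum.inl i) := by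
    intro i
    rw [comps_mul, ← hΦ, ← comps_mul, mul_inv_cancel, comps_one]
  refine ⟨fun j => comps (U * Φ⁻¹) (Sum.inr j), squareManifold (U * Φ⁻¹), fun _ => rfl,
    conditionD_squareManifold hV, reflections (U * Φ⁻¹),
    FormalSubmanifold.isAssociatedFamily_reflections (deck_squareManifold hV), Φ, hΦρ, 1,
    fun j => ?_⟩
  rw [Equiv.Perm.one_apply, reflections, reflections, conjFlip_apply, conjFlip_apply]
  group

end CRSing

end

theorem mainTheorem12 (p : ℕ) :
    -- the associated family of involutions exists and is unique up to the order of its members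
    (∀ M : CRSing.FormalSubmanifold p, M.ConditionD →
      ∃ τ : Fin p → CRSing.FormalBihol (CRSing.ZW p), M.IsAssociatedFamily τ ∧
        ∀ τ' : Fin p → CRSing.FormalBihol (CRSing.ZW p), M.IsAssociatedFamily τ' →
          Set.range τ' = Set.range τ) ∧
    -- formal equivalence of the manifolds is equivalence of the families
    (∀ M M' : CRSing.FormalSubmanifold p, M.ConditionD → M'.ConditionD →
      ∀ τ τ' : Fin p → CRSing.FormalBihol (CRSing.ZW p),
        M.IsAssociatedFamily τ → M'.IsAssociatedFamily τ' →
          (M.FormallyEquivalent M' ↔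
            CRSing.FamilyEquivalent τ (CRSing.rho0 p) τ' (CRSing.rho0 p))) ∧
    -- realization of abstract families
    (∀ (τ : Fin p → CRSing.FormalBihol (CRSing.ZW p)) (ρ : CRSing.AntiInvolution (CRSing.ZW p)),
      (∀ j, τ j * τ j = 1) →
      (∀ i j, τ i * τ j = τ j * τ i) →
      -- the tangent spaces of `Fix(τ_j)` are hyperplanes
      (∀ j, Module.finrank ℂ (CRSing.tangentSpace (CRSing.fixIdeal (τ j))) + 1 = 2 * p) →
      -- they intersect transversally: the intersection has codimension `p`
      Module.finrank ℂ
        (⨅ j, CRSing.tangentSpace (CRSing.fixIdeal (τ j)) :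
          Submodule ℂ (CRSing.ZW p → ℂ)) + p = 2 * p →
      -- `σ = τ₁ ∘ τ₂`, with `τ_i = τ_{i1} ⋯ τ_{ip}`, has distinct eigenvalues
      (CRSing.linearPart (CRSing.composite τ *
        CRSing.composite fun j => ρ.conjugate (τ j))).charpoly.roots.Nodup →
      CRSing.linearInvariants τ ⊓
        CRSing.linearInvariants (fun j => ρ.conjugate (τ j)) = ⊥ →
      ∃ (B : Fin p → MvPowerSeries (CRSing.ZW p) ℂ) (M : CRSing.FormalSubmanifold p),
        (∀ j, M.E j = B j ^ 2) ∧ M.ConditionD ∧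
          ∃ τ' : Fin p → CRSing.FormalBihol (CRSing.ZW p), M.IsAssociatedFamily τ' ∧
            CRSing.FamilyEquivalent τ ρ τ' (CRSing.rho0 p)) := by
  refine ⟨fun M hM => CRSing.FormalSubmanifold.existsUnique_associatedFamily hM,
    fun M M' hM hM' τ τ' hτ hτ' =>
      CRSing.FormalSubmanifold.formallyEquivalent_iff_familyEquivalent hM hM' hτ hτ',
    fun τ ρ h2 hcomm hhyp htrans _ hinv =>
      CRSing.exists_realization τ ρ h2 hcomm hhyp htrans hinv⟩
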